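/- Let $K$ be a unital commutative $\mathbb Q$-algebra and $z=(z_1,\dots,z_n)$ free variables, either commutative or noncommutative. Write $K\langle\langle z\rangle\rangle$ and $K[[t]]\langle\langle z\rangle\rangle$ for the algebras of formal power series in $z$ over $K$ and $K[[t]]$, where $t$ is a central parameter. Let $\alpha\ge 1$ and let $F_t$ be an automorphism of $K[[t]]\langle\langle z\rangle\rangle$ over $K[[t]]$ with $F_t(z)=z-H_t(z)$, where $H_t(z)$ has order at least $\alpha$ in $z$ and $H_{t=0}(z)=0$. Let $G_t=F_t^{-1}$ and $G_t(z)=z+M_t(z)$. For a tuple $v$, let $\left[v\frac{\partial}{\partial z}\right]$ be the derivation that maps $z_i$ to $v_i$ for all $i$. Identify $K[[t]]$-linear operators of $K[[t]]\langle\langle z\rangle\rangle$ with power series in $t$ whose coefficients are $K$-linear operators of $K\langle\langle z\rangle\rangle$, and define such series $f,g,d,h,m$ and operators $\lambda_m,s_m,\phi_m,\psi_m,\xi_m$ by $$f(-t)\,w=w(F_t),\qquad g(t)\,w=w(G_t)\quad (w\in K[[t]]\langle\langle z\rangle\rangle),\qquad e^{d(t)}=g(t),\ d(0)=0,$$ $$h(t)=\left[\frac{\partial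 M_t}{\partial t}(F_t)\frac{\partial}{\partial z}\right],\qquad m(t)=\left[\frac{\partial H_t}{\partial t}(G_t)\frac{\partial}{\partial z}\right],$$ $$f(t)=\sum_{m\ge0}t^m\lambda_m,\quad g(t)=\sum_{m\ge0}t^ms_m,\quad d(t)=\sum_{m\ge1}\frac{t^m}{m}\phi_m,\quad h(t)=\sum_{m\ge1}t^{m-1}\psi_m,\quad m(t)=\sum_{m\ge1}t^{m-1}\xi_m.$$ Let $\mathcal C$ be the set of compositions, i.e. nonempty finite sequences $I=(i_1,\dots,i_k)$ of positive integers. Put $\ell(I)=k$, $|I|=i_1+\cdots+i_k$, $sp(I)=k!\,i_1\cdots i_k$, $\pi_u(I)=\prod_{j=1}^k(i_1+\cdots+i_j)$, and $w^I=w_{i_1}\cdots w_{i_k}$ for a sequence $(w_m)_{m\ge1}$. Write $I\succeq J$ if $I$ is a refinement of $J=(j_1,\dots,j_r)$, i.e. $I$ is the concatenation of compositions $I_1,\dots,I_r$ with $|I_a|=j_a$, and put $\pi_u(I,J)=\prod_{a=1}^r\pi_u(I_a)$. Then $d(t)$ exists and is unique, and, for a further central parameter $u$, the formal flow $F_t(z,u):=e^{-u\,d(t)}z$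 satisfies, over $K[u][[t]]$, $$F_t(z,u)=z+\sum_{I\in\mathcal C}\frac{(-u)^{\ell(I)}}{sp(I)}\,t^{|I|}\,\phi^I z,$$ $$F_t(z,u)=z+\sum_{I\in\mathcal C}(-1)^{|I|}\binom{u}{\ell(I)}\,t^{|I|}\,\lambda^I z,$$ $$F_t(z,u)=z+\sum_{I\in\mathcal C}\binom{-u}{\ell(I)}\,t^{|I|}\,s^I z,$$ $$F_t(z,u)=z+\sum_{I\in\mathcal C}\Bigl(\sum_{I\succeq J}\frac{\binom{-u}{\ell(J)}}{\pi_u(I,J)}\Bigr)t^{|I|}\,\psi^I z,$$ $$F_t(z,u)=z+\sum_{I\in\mathcal C}(-1)^{\ell(I)}\Bigl(\sum_{I\succeq J}\frac{\binom{u}{\ell(J)}}{\pi_u(I,J)}\Bigr)t^{|I|}\,\xi^I z.$$ -/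

import Mathlib

open Polynomial

noncomputable section

namespace FormalFlow

/-! ### Formal power series over a monoid of monomials -/

/-- Formal power series with coefficients in `R` and monomials in `M` (written additively,
but not assumed commutative). -/
structure FormalSeries (M R : Type*) where
  /-- The coefficient of a monomial. -/
  coeff : M → R

namespace FormalSeries

variable {M R : Type*}

@[ext] theorem ext {f g : FormalSeries M R} (h : ∀ x, f.coeff x = g.coeff x) : f = g := by
  cases f; cases g; congr; exact funext h

theorem coeff_injective : Function.Injective (coeff : FormalSeries M R → M → R) :=
  fun _ _ h => ext (congrFun h)

section Module

variable [CommRing R]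

instance : Zero (FormalSeries M R) := ⟨⟨0⟩⟩
instance : Add (FormalSeries M R) := ⟨fun f g => ⟨f.coeff + g.coeff⟩⟩
instance : Neg (FormalSeries M R) := ⟨fun f => ⟨-f.coeff⟩⟩
instance : Sub (FormalSeries M R) := ⟨fun f g => ⟨f.coeff - g.coeff⟩⟩
instance {S : Type*} [SMul S R] : SMul S (FormalSeries M R) := ⟨fun c f => ⟨c • f.coeff⟩⟩

instance : AddCommGroup (FormalSeries M R) :=
  coeff_injective.addCommGroup _ rfl (fun _ _ => rfl) (fun _ => rfl) (fun _ _ => rfl)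
    (fun _ _ => rfl) (fun _ _ => rfl)

instance : Module R (FormalSeries M R) :=
  coeff_injective.module R ⟨⟨coeff, rfl⟩, fun _ _ => rfl⟩ (fun _ _ => rfl)

theorem add_apply (f g : FormalSeries M R) (x : M) : (f + g).coeff x = f.coeff x + g.coeff x := rfl

theorem smul_apply (a : R) (f : FormalSeries M R) (x : M) : (a • f).coeff x = a * f.coeff x := rfl

theorem zero_apply (x : M) : (0 : FormalSeries M R).coeff x = 0 := rfl

end Module

open Classical in
/-- The series consisting of the single monomial `x`. -/
def single [CommRing R] (x : M) : FormalSeries M R := ⟨fun y => if y = x then 1 else 0⟩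

variable [AddMonoid M] [Finset.HasAntidiagonal M] [CommRing R]

instance : One (FormalSeries M R) := ⟨single 0⟩

/-- The Cauchy product. -/
instance : Mul (FormalSeries M R) :=
  ⟨fun f g => ⟨fun x => ∑ p ∈ Finset.HasAntidiagonal.antidiagonal x, f.coeff p.1 * g.coeff p.2⟩⟩

theorem mul_apply (f g : FormalSeries M R) (x : M) :
    (f * g).coeff x = ∑ p ∈ Finset.HasAntidiagonal.antidiagonal x, f.coeff p.1 * g.coeff p.2 := rfl

open Classical in
theorem one_apply (x : M) : (1 : FormalSeries M R).coeff x = if x = 0 then 1 else 0 := rfl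

protected theorem one_mul' (f : FormalSeries M R) : 1 * f = f := by
  ext x
  rw [mul_apply, Finset.sum_eq_single (0, x)]
  · simp [one_apply]
  · rintro ⟨a, b⟩ hab hne
    rw [Finset.HasAntidiagonal.mem_antidiagonal] at hab
    have : a ≠ 0 := by
      rintro rfl
      apply hne
      simpa using hab
    simp [one_apply, this]
  · intro h
    simp at h

protected theorem mul_one' (f : FormalSeries M R) : f * 1 = f := by
  ext x
  rw [mul_apply, Finset.sum_eq_single (x, 0)]
  · simp [one_apply]
  · rintro ⟨a, b⟩ hab hne
    rw [Finset.HasAntidiagonal.mem_antidiagonal] at hab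
    have : b ≠ 0 := by
      rintro rfl
      apply hne
      simpa using hab
    simp [one_apply, this]
  · intro h
    simp at h

protected theorem mul_assoc' (f g h : FormalSeries M R) : f * g * h = f * (g * h) := by
  ext x
  simp only [mul_apply, Finset.sum_mul, Finset.mul_sum, Finset.sum_sigma']
  refine Finset.sum_nbij' (fun q => ⟨(q.2.1, q.2.2 + q.1.2), (q.2.2, q.1.2)⟩)
    (fun q => ⟨(q.1.1 + q.2.1, q.2.2), (q.1.1, q.2.1)⟩) ?_ ?_ ?_ ?_ ?_ <;>
  rintro ⟨⟨a, b⟩, ⟨c, d⟩⟩ hq <;>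
  simp only [Finset.mem_sigma, Finset.HasAntidiagonal.mem_antidiagonal] at hq ⊢ <;>
  obtain ⟨h1, h2⟩ := hq <;> subst h1 <;> subst h2 <;>
  simp [add_assoc, mul_assoc]

instance : Ring (FormalSeries M R) :=
  { (inferInstance : AddCommGroup (FormalSeries M R)) with
    one := 1
    mul := (· * ·)
    one_mul := FormalSeries.one_mul'
    mul_one := FormalSeries.mul_one'
    mul_assoc := FormalSeries.mul_assoc'
    zero_mul := fun f => by ext x; simp [mul_apply, zero_apply]
    mul_zero := fun f => by ext x; simp [mul_apply, zero_apply]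
    left_distrib := fun f g h => by
      ext x; simp [mul_apply, add_apply, mul_add, Finset.sum_add_distrib]
    right_distrib := fun f g h => by
      ext x; simp [mul_apply, add_apply, add_mul, Finset.sum_add_distrib] }

instance : Algebra R (FormalSeries M R) :=
  Algebra.ofModule
    (fun r f g => by
      ext x; simp [mul_apply, smul_apply, Finset.mul_sum, mul_assoc])
    (fun r f g => by
      ext x; simp [mul_apply, smul_apply, Finset.mul_sum, mul_left_comm])

end FormalSeries

/-! ### Commutative and noncommutative variables -/

/-- Whether the free variables `z₁, …, zₙ` commute with each other. -/
inductive VarKind : Type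
  | commutative
  | noncommutative

/-- Monomials in `z₁, …, zₙ`: exponent vectors if the variables commute, words if not. -/
abbrev Monomial (n : ℕ) : VarKind → Type
  | .commutative => Fin n →₀ ℕ
  | .noncommutative => FreeAddMonoid (Fin n)

instance (n : ℕ) : ∀ k : VarKind, AddMonoid (Monomial n k)
  | .commutative => inferInstanceAs (AddMonoid (Fin n →₀ ℕ))
  | .noncommutative => inferInstanceAs (AddMonoid (FreeAddMonoid (Fin n)))

open Classical in
/-- The factorizations of a word into two words. -/
instance (n : ℕ) : Finset.HasAntidiagonal (FreeAddMonoid (Fin n)) where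
  antidiagonal w := (Finset.range (w.toList.length + 1)).image fun j =>
    (FreeAddMonoid.ofList (w.toList.take j), FreeAddMonoid.ofList (w.toList.drop j))
  mem_antidiagonal := by
    rintro w ⟨a, b⟩
    simp only [Finset.mem_image, Finset.mem_range, Prod.mk.injEq]
    constructor
    · rintro ⟨j, -, rfl, rfl⟩
      rw [← FreeAddMonoid.ofList_append, List.take_append_drop]
      rfl
    · rintro rfl
      refine ⟨a.toList.length, ?_, ?_, ?_⟩
      · simp [FreeAddMonoid.toList_add]
      · simp [FreeAddMonoid.toList_add]
      · simp [FreeAddMonoid.toList_add]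

instance (n : ℕ) : ∀ k : VarKind, Finset.HasAntidiagonal (Monomial n k)
  | .commutative => inferInstanceAs (Finset.HasAntidiagonal (Fin n →₀ ℕ))
  | .noncommutative => inferInstanceAs (Finset.HasAntidiagonal (FreeAddMonoid (Fin n)))

/-- The monomial `zᵢ`. -/
def Monomial.var {n : ℕ} : ∀ {k : VarKind}, Fin n → Monomial n k
  | .commutative, i => (Finsupp.single i 1 : Fin n →₀ ℕ)
  | .noncommutative, i => FreeAddMonoid.of i

/-- The total degree of a monomial in `z`. -/
def Monomial.degree {n : ℕ} : ∀ {k : VarKind}, Monomial n k → ℕ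
  | .commutative, (x : Fin n →₀ ℕ) => ∑ i, x i
  | .noncommutative, (x : FreeAddMonoid (Fin n)) => x.toList.length

/-- The algebra `R⟨⟨z⟩⟩` of formal power series in `z = (z₁, …, zₙ)` over `R`. -/
abbrev Ser (k : VarKind) (n : ℕ) (R : Type*) : Type _ := FormalSeries (Monomial n k) R

/-- The variable `zᵢ` as an element of `R⟨⟨z⟩⟩`. -/
def z {k : VarKind} {n : ℕ} {R : Type*} [CommRing R] (i : Fin n) : Ser k n R :=
  FormalSeries.single (Monomial.var i)

/-- The derivation `[v ∂/∂z]` for commuting variables: `f ↦ ∑ᵢ vᵢ ∂f/∂zᵢ`. -/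
def commDer {n : ℕ} {R : Type*} [CommRing R] (v : Fin n → FormalSeries (Fin n →₀ ℕ) R) :
    Module.End R (FormalSeries (Fin n →₀ ℕ) R) where
  toFun f := ⟨fun x => ∑ i, ∑ p ∈ Finset.HasAntidiagonal.antidiagonal x,
    (v i).coeff p.1 * (((p.2 i : R) + 1) * f.coeff (p.2 + Finsupp.single i 1))⟩
  map_add' f g := by
    ext x
    simp only [FormalSeries.add_apply, mul_add, Finset.sum_add_distrib]
  map_smul' r f := by
    ext x
    simp only [FormalSeries.smul_apply, Finset.mul_sum, RingHom.id_apply, mul_left_comm]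

/-- The derivation `[v ∂/∂z]` for noncommuting variables. It replaces in each word one letter
`zᵢ` by `vᵢ`, in all possible ways: the coefficient of the result at a word `x` is the sum of
`vᵢ(b) f(a zᵢ c)` over all `i` and all factorizations `x = a b c`. -/
def wordDer {n : ℕ} {R : Type*} [CommRing R] (v : Fin n → FormalSeries (FreeAddMonoid (Fin n)) R) :
    Module.End R (FormalSeries (FreeAddMonoid (Fin n)) R) where
  toFun f := ⟨fun x => ∑ i, ∑ p ∈ Finset.HasAntidiagonal.antidiagonal x,
    ∑ q ∈ Finset.HasAntidiagonal.antidiagonal p.2,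
      (v i).coeff q.1 * f.coeff (p.1 + FreeAddMonoid.of i + q.2)⟩
  map_add' f g := by
    ext x
    simp only [FormalSeries.add_apply, mul_add, Finset.sum_add_distrib]
  map_smul' r f := by
    ext x
    simp only [FormalSeries.smul_apply, Finset.mul_sum, RingHom.id_apply, mul_left_comm]

/-- The `R`-derivation `[v ∂/∂z]` of `R⟨⟨z⟩⟩`, which maps `zᵢ` to `vᵢ`. -/
def vecDer {n : ℕ} {R : Type*} [CommRing R] :
    ∀ {k : VarKind}, (Fin n → Ser k n R) → Module.End R (Ser k n R)
  | .commutative, v => commDer v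
  | .noncommutative, v => wordDer v

/-! ### The parameter `t` -/

section Parameter

variable {k : VarKind} {n : ℕ} {K : Type*} [CommRing K]

/-- The inclusion of `K⟨⟨z⟩⟩` into `K[[t]]⟨⟨z⟩⟩`. -/
def constT (a : Ser k n K) : Ser k n (PowerSeries K) :=
  ⟨fun x => PowerSeries.C (a.coeff x)⟩

/-- The coefficient of `t ^ m`, from `K[[t]]⟨⟨z⟩⟩` to `K⟨⟨z⟩⟩`. -/
def tCoeff (m : ℕ) (a : Ser k n (PowerSeries K)) : Ser k n K :=
  ⟨fun x => PowerSeries.coeff m (a.coeff x)⟩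

/-- The coefficientwise derivative `∂/∂t` on `K[[t]]⟨⟨z⟩⟩`. -/
def tDeriv (a : Ser k n (PowerSeries K)) : Ser k n (PowerSeries K) :=
  ⟨fun x => PowerSeries.derivative K (a.coeff x)⟩

/-- A `K[[t]]`-linear operator `T` of `K[[t]]⟨⟨z⟩⟩` as a power series `∑ₘ t ^ m Tₘ` in `t` whose
coefficients are operators of `K⟨⟨z⟩⟩`. -/
def opSeries (T : Module.End (PowerSeries K) (Ser k n (PowerSeries K))) :
    PowerSeries (Module.End K (Ser k n K)) :=
  PowerSeries.mk fun m =>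
    { toFun := fun a => tCoeff m (T (constT a))
      map_add' := fun a b => by
        have h : constT (a + b) = constT a + constT b := by
          ext1 x; simp [constT, FormalSeries.add_apply]
        rw [h, map_add]
        ext x
        simp [tCoeff, FormalSeries.add_apply]
      map_smul' := fun r a => by
        have h : constT (r • a) = PowerSeries.C r • constT a := by
          ext1 x; simp [constT, FormalSeries.smul_apply]
        rw [h, map_smul]
        ext x
        simp [tCoeff, FormalSeries.smul_apply] }

/-- `K[[t]]`-algebra automorphisms of `K[[t]]⟨⟨z⟩⟩`. The automorphism `F` is identified with the
tuple `F(z)`, and `F u` is `u(F(z))`. -/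
abbrev Aut (k : VarKind) (n : ℕ) (K : Type*) [CommRing K] : Type _ :=
  Ser k n (PowerSeries K) ≃ₐ[PowerSeries K] Ser k n (PowerSeries K)

/-- `H` with `F(z) = z - H(z)`. -/
def Hpart (F : Aut k n K) (i : Fin n) : Ser k n (PowerSeries K) := z i - F (z i)

/-- `M` with `G(z) = z + M(z)`, where `G` is the inverse of `F`. -/
def Mpart (F : Aut k n K) (i : Fin n) : Ser k n (PowerSeries K) := F.symm (z i) - z i

/-- `F(z) = z - H(z)` where `H` has order at least `α` in `z` and vanishes at `t = 0`. -/
structure MemAut (α : ℕ) (F : Aut k n K) : Prop where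
  order : ∀ i x, Monomial.degree x < α → (Hpart F i).coeff x = 0
  at_zero : ∀ i x, PowerSeries.constantCoeff ((Hpart F i).coeff x) = 0

end Parameter

/-! ### Exponential and logarithm of a power series in `t` -/

section ExpLog

variable (K : Type*) [CommRing K] [Algebra ℚ K] {B : Type*} [Ring B] [Algebra K B]

/-- `e ^ P = ∑ⱼ P ^ j / j!`, for a power series `P` in `t` without constant term. -/
def expSeries (P : PowerSeries B) : PowerSeries B :=
  PowerSeries.mk fun m => ∑ j ∈ Finset.range (m + 1),
    algebraMap ℚ K (1 / (j.factorial : ℚ)) • PowerSeries.coeff m (P ^ j)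

/-- `log P = ∑_{j ≥ 1} (-1) ^ (j - 1) (P - 1) ^ j / j`, for a power series `P` in `t` with
constant term `1`. -/
def logSeries (P : PowerSeries B) : PowerSeries B :=
  PowerSeries.mk fun m => ∑ j ∈ Finset.Icc 1 m,
    algebraMap ℚ K ((-1) ^ (j + 1) / (j : ℚ)) • PowerSeries.coeff m ((P - 1) ^ j)

end ExpLog

/-! ### The system `(f, g, d, h, m)` of an automorphism -/

section System

variable {k : VarKind} {n : ℕ} {K : Type*} [CommRing K]

/-- `f(t)`, with `f(-t) u = u(F)`. -/
def fSeries (F : Aut k n K) : PowerSeries (Module.End K (Ser k n K)) :=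
  PowerSeries.mk fun m => (-1) ^ m * PowerSeries.coeff m (opSeries F.toLinearMap)

/-- `g(t)`, with `g(t) u = u(G)`. -/
def gSeries (F : Aut k n K) : PowerSeries (Module.End K (Ser k n K)) :=
  opSeries F.symm.toLinearMap

/-- `d(t)`, with `e ^ d(t) = g(t)`. -/
def dSeries [Algebra ℚ K] (F : Aut k n K) : PowerSeries (Module.End K (Ser k n K)) :=
  logSeries K (gSeries F)

/-- `h(t) = [(∂M/∂t)(F) ∂/∂z]`. -/
def hSeries (F : Aut k n K) : PowerSeries (Module.End K (Ser k n K)) :=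
  opSeries (vecDer fun i => F (tDeriv (Mpart F i)))

/-- `m(t) = [(∂H/∂t)(G) ∂/∂z]`. -/
def mSeries (F : Aut k n K) : PowerSeries (Module.End K (Ser k n K)) :=
  opSeries (vecDer fun i => F.symm (tDeriv (Hpart F i)))

/-- `f(t) = ∑ t ^ m λₘ`. -/
def lam (F : Aut k n K) (m : ℕ) : Module.End K (Ser k n K) := PowerSeries.coeff m (fSeries F)

/-- `g(t) = ∑ t ^ m sₘ`. -/
def s (F : Aut k n K) (m : ℕ) : Module.End K (Ser k n K) := PowerSeries.coeff m (gSeries F)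

/-- `d(t) = ∑_{m ≥ 1} t ^ m φₘ / m`. -/
def phi [Algebra ℚ K] (F : Aut k n K) (m : ℕ) : Module.End K (Ser k n K) :=
  m • PowerSeries.coeff m (dSeries F)

/-- `h(t) = ∑_{m ≥ 1} t ^ (m - 1) ψₘ`; only the indices `m ≥ 1` are used. -/
def psi (F : Aut k n K) (m : ℕ) : Module.End K (Ser k n K) := PowerSeries.coeff (m - 1) (hSeries F)

/-- `m(t) = ∑_{m ≥ 1} t ^ (m - 1) ξₘ`; only the indices `m ≥ 1` are used. -/
def xi (F : Aut k n K) (m : ℕ) : Module.End K (Ser k n K) := PowerSeries.coeff (m - 1) (mSeries F)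

/-! ### The formal flow; `u` is the variable of `K[u]` -/

/-- `P(u, t) a`, for a power series `P` in `t` whose coefficients are polynomials in `u` with
operators of `K⟨⟨z⟩⟩` as coefficients, and `a ∈ K⟨⟨z⟩⟩`; an element of `K[u][[t]]⟨⟨z⟩⟩`. -/
def applyU (P : PowerSeries (Module.End K (Ser k n K))[X]) (a : Ser k n K) :
    Ser k n (PowerSeries K[X]) :=
  ⟨fun x => PowerSeries.mk fun m =>
    (PowerSeries.coeff m P).sum fun j T => Polynomial.monomial j ((T a).coeff x)⟩

/-- The formal flow `F(z, u) = e ^ (-u d(t)) z`. -/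
def flow [Algebra ℚ K] (F : Aut k n K) (i : Fin n) : Ser k n (PowerSeries K[X]) :=
  applyU (expSeries K
    (-(PowerSeries.C (X : (Module.End K (Ser k n K))[X]) *
      PowerSeries.map Polynomial.C (dSeries F)))) (z i)

/-! ### Compositions -/

/-- `w ^ I = w_{i₁} w_{i₂} ⋯ w_{iₘ}`. -/
def word {B : Type*} [Monoid B] (w : ℕ → B) {m : ℕ} (I : Composition m) : B :=
  (I.blocks.map w).prod

/-- `∑ c(I) t ^ |I| w ^ I a` over all (nonempty) compositions `I`, an element of
`K[u][[t]]⟨⟨z⟩⟩`; the coefficient of `t ^ m` is the sum over the compositions `I` of `m`. -/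
def compSum (c : ∀ {m : ℕ}, Composition m → K[X]) (w : ℕ → Module.End K (Ser k n K))
    (a : Ser k n K) : Ser k n (PowerSeries K[X]) :=
  ⟨fun x => PowerSeries.mk fun m =>
    if m = 0 then 0 else ∑ I : Composition m, c I * Polynomial.C ((word w I a).coeff x)⟩

end System

/-- `π(I) = i₁ i₂ ⋯ iₘ`. -/
def piProd (l : List ℕ) : ℕ := l.prod

/-- `sp(I) = ℓ(I)! π(I)`. -/
def sp (l : List ℕ) : ℕ := l.length.factorial * piProd l

/-- `π_u(I) = i₁ (i₁ + i₂) ⋯ (i₁ + ⋯ + iₘ)`. -/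
def piU (l : List ℕ) : ℕ := ∏ j ∈ Finset.range l.length, (l.take (j + 1)).sum

/-- `π_u(I, J) = ∏ₐ π_u(Iₐ)`, where `J = I.gather b` is the composition that has `I` as a
refinement by grouping the parts of `I` into consecutive lists `I₁, I₂, …` of the lengths
prescribed by `b`. -/
def piURel {m : ℕ} (I : Composition m) (b : Composition I.length) : ℕ :=
  ((I.blocks.splitWrtComposition b).map piU).prod

/-- The polynomial `binom(p, j) = p (p - 1) ⋯ (p - j + 1) / j!`. -/
def binom {K : Type*} [CommRing K] [Algebra ℚ K] (p : K[X]) (j : ℕ) : K[X] :=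
  Polynomial.C (algebraMap ℚ K (1 / (j.factorial : ℚ))) * ∏ a ∈ Finset.range j, (p - (a : K[X]))

/-- `∑ binom(p, ℓ(J)) / π_u(I, J)` over all compositions `J` that have `I` as a refinement. These
are the `I.gather b`, one for each way `b` of grouping the parts of `I`. -/
def coarseSum {K : Type*} [CommRing K] [Algebra ℚ K] (p : K[X]) {m : ℕ} (I : Composition m) :
    K[X] :=
  ∑ b : Composition I.length,
    Polynomial.C (algebraMap ℚ K (1 / (piURel I b : ℚ))) * binom p (I.gather b).length

end FormalFlow

end

/-!
Write `E(t)` for the operator series of `F`, so that `E(t) = f(-t)` and `g(t) E(t) = 1`. All the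
series have coefficients in the noncommutative algebra of operators of `K⟨⟨z⟩⟩`, but each of
`d`, `g - 1` and `E - 1` lies in the image of a substitution homomorphism `K[[x]] → B[[t]]`,
`x ↦ P` (`evalHom`). Hence the one-variable identities `log (exp x) = x`, `exp (log (1 + x)) = 1 + x`
and `exp (p log (1 + x)) = ∑ⱼ binom(p, j) x ^ j` carry over (`logSeries_expSeries`,
`expSeries_logSeries`, `expSeries_smul_logSeries`). They give the existence and uniqueness of `d`, and
`e ^ (-u d) = ∑ⱼ (-u) ^ j d ^ j / j! = ∑ⱼ binom(-u, j) (g - 1) ^ j = ∑ⱼ binom(u, j) (E - 1) ^ j`.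
The coefficient of `t ^ m` in the `j`-th power of a series without constant term is a sum over
the compositions of `m` with `j` parts (`coeff_pow_eq_sum_composition`), which yields the expansions
in `φ`, `s` and `λ`.

The expansions in `ψ` and `ξ` rest on the differential equations `g' = g h` and `E' = -E m`. Their
solutions are `s_m = ∑ ψ ^ I / π_u(I)`, over the compositions `I` of `m`, and likewise for `E` and
`-ξ` (`eq_sum_composition_of_recurrence`). Inserting them into the expansions in `s` and `λ` and
collecting the terms with the same refinement gives the sums over `I ≽ J` (`sum_composition_word`).

The differential equations hold because, for an automorphism `Φ`, both `∂/∂t ∘ Φ` and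
`Φ ∘ [Φ⁻¹(∂Φ(z)/∂t) ∂/∂z]` satisfy the Leibniz rule with respect to `Φ` on `K⟨⟨z⟩⟩` and agree on the
variables (`tDeriv_aut`). No continuity of `Φ` has to be assumed: since `Φ(zᵢ) ∈ (z, t)`, the
difference `D` of the two maps satisfies `D(zᵢ w) = Φ(zᵢ) D(w)`, and every series is a constant plus
a finite combination `∑ zᵢ wᵢ`, so the values of `D` lie in all powers of `(z, t)`
(`eq_zero_of_map_var_mul`). The same argument shows that `F`, and hence its inverse, is the
identity modulo `t`.
-/

noncomputable section

namespace FormalFlow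

/-! ### Substitution into power series with noncommuting coefficients -/

section Evaluation

variable {R E : Type*} [CommRing R] [Ring E] [Algebra R E]

theorem coeff_pow_eq_zero {P : PowerSeries E} (hP : PowerSeries.constantCoeff P = 0) :
    ∀ {j m : ℕ}, m < j → PowerSeries.coeff m (P ^ j) = 0
  | 0, _, h => by simp at h
  | j + 1, m, h => by
    rw [pow_succ, PowerSeries.coeff_mul]
    refine Finset.sum_eq_zero fun p hp => ?_
    rw [Finset.HasAntidiagonal.mem_antidiagonal] at hp
    rcases Nat.eq_zero_or_pos p.2 with h0 | h0
    · rw [h0, PowerSeries.coeff_zero_eq_constantCoeff_apply, hP, mul_zero]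
    · rw [coeff_pow_eq_zero hP (by omega), zero_mul]

/-- The series `∑ⱼ fⱼ P ^ j` obtained by substituting for the variable of `f` a power series `P`
without constant term, whose coefficients need not commute. -/
def evalSeries (P : PowerSeries E) (f : PowerSeries R) : PowerSeries E :=
  PowerSeries.mk fun m => ∑ j ∈ Finset.range (m + 1),
    PowerSeries.coeff j f • PowerSeries.coeff m (P ^ j)

/-- Up to degree `m`, substituting into a power series is the same as substituting into any
polynomial that agrees with it up to degree `m`. -/
theorem coeff_evalSeries {P : PowerSeries E} (hP : PowerSeries.constantCoeff P = 0)
    {f : PowerSeries R} {m : ℕ} {p : R[X]} (hp : ∀ j ≤ m, p.coeff j = PowerSeries.coeff j f) :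
    PowerSeries.coeff m (evalSeries P f) = PowerSeries.coeff m (aeval P p) := by
  rw [aeval_eq_sum_range' (n := p.natDegree + 1 + (m + 1)) (by omega), map_sum, evalSeries,
    PowerSeries.coeff_mk]
  refine (Finset.sum_subset_zero_on_sdiff (Finset.range_mono (by omega)) ?_ ?_)
  · intro j hj
    simp only [Finset.mem_sdiff, Finset.mem_range] at hj
    rw [PowerSeries.coeff_smul, coeff_pow_eq_zero hP (by omega), smul_zero]
  · intro j hj
    rw [Finset.mem_range] at hj
    rw [PowerSeries.coeff_smul, hp j (by omega)]

theorem coeff_trunc_of_le {f : PowerSeries R} {m j : ℕ} (h : j ≤ m) :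
    (PowerSeries.trunc (m + 1) f).coeff j = PowerSeries.coeff j f := by
  rw [PowerSeries.coeff_trunc, if_pos (by omega)]

theorem coeff_evalSeries_trunc {P : PowerSeries E} (hP : PowerSeries.constantCoeff P = 0)
    {f : PowerSeries R} {m a : ℕ} (h : m ≤ a) :
    PowerSeries.coeff m (evalSeries P f) =
      PowerSeries.coeff m (aeval P (PowerSeries.trunc (a + 1) f)) :=
  coeff_evalSeries hP fun _ hj => coeff_trunc_of_le (hj.trans h)

theorem evalSeries_congr (P : PowerSeries E) {f g : PowerSeries R} {m : ℕ}
    (h : ∀ j ≤ m, PowerSeries.coeff j f = PowerSeries.coeff j g) :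
    PowerSeries.coeff m (evalSeries P f) = PowerSeries.coeff m (evalSeries P g) := by
  simp only [evalSeries, PowerSeries.coeff_mk]
  exact Finset.sum_congr rfl fun j hj => by
    rw [h j (by rw [Finset.mem_range] at hj; omega)]

/-- Substitution of `P` as a homomorphism of algebras. -/
def evalHom (P : PowerSeries E) (hP : PowerSeries.constantCoeff P = 0) :
    PowerSeries R →ₐ[R] PowerSeries E :=
  AlgHom.ofLinearMap
    { toFun := evalSeries P
      map_add' := fun f g => by
        ext m
        simp [evalSeries, add_smul, Finset.sum_add_distrib]
      map_smul' := fun r f => by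
        ext m
        simp [evalSeries, Finset.smul_sum, mul_smul] }
    (by
      ext m
      change PowerSeries.coeff m (evalSeries P 1) = _
      rw [coeff_evalSeries hP (p := 1), map_one]
      intro j _
      rw [Polynomial.coeff_one, PowerSeries.coeff_one])
    (fun f g => by
      ext m
      change PowerSeries.coeff m (evalSeries P (f * g)) =
        PowerSeries.coeff m (evalSeries P f * evalSeries P g)
      have h : ∀ j ≤ m, (PowerSeries.trunc (m + 1) f * PowerSeries.trunc (m + 1) g).coeff j =
          PowerSeries.coeff j (f * g) := fun j hj => by
        rw [Polynomial.coeff_mul, PowerSeries.coeff_mul]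
        refine Finset.sum_congr rfl fun p hp => ?_
        rw [Finset.HasAntidiagonal.mem_antidiagonal] at hp
        rw [coeff_trunc_of_le (by omega), coeff_trunc_of_le (by omega)]
      rw [coeff_evalSeries hP h, map_mul, PowerSeries.coeff_mul, PowerSeries.coeff_mul]
      refine Finset.sum_congr rfl fun p hp => ?_
      rw [Finset.HasAntidiagonal.mem_antidiagonal] at hp
      rw [coeff_evalSeries_trunc hP (a := m) (by omega),
        coeff_evalSeries_trunc hP (a := m) (by omega)])

theorem evalHom_apply (P : PowerSeries E) (hP : PowerSeries.constantCoeff P = 0)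
    (f : PowerSeries R) : evalHom P hP f = evalSeries P f := rfl

theorem evalSeries_X {P : PowerSeries E} (hP : PowerSeries.constantCoeff P = 0) :
    evalSeries P (PowerSeries.X : PowerSeries R) = P := by
  ext m
  rw [coeff_evalSeries hP (p := X), aeval_X]
  intro j _
  rw [Polynomial.coeff_X, PowerSeries.coeff_X]
  simp [eq_comm]

theorem evalSeries_C_mul (P : PowerSeries E) (r : R) (f : PowerSeries R) :
    evalSeries P (PowerSeries.C r * f) = r • evalSeries P f := by
  ext m
  simp [evalSeries, Finset.smul_sum, mul_smul]

theorem constantCoeff_evalSeries (P : PowerSeries E) (f : PowerSeries R) :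
    PowerSeries.constantCoeff (evalSeries P f) = PowerSeries.constantCoeff f • 1 := by
  rw [← PowerSeries.coeff_zero_eq_constantCoeff_apply, evalSeries, PowerSeries.coeff_mk]
  simp

/-- Substitution is associative. -/
theorem evalSeries_evalSeries {P : PowerSeries E} (hP : PowerSeries.constantCoeff P = 0)
    {f : PowerSeries R} (hf : PowerSeries.constantCoeff f = 0) (g : PowerSeries R) :
    evalSeries (evalSeries P f) g = evalSeries P (evalSeries f g) := by
  ext m
  rw [coeff_evalSeries_trunc (by rw [constantCoeff_evalSeries, hf, zero_smul]) le_rfl,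
    ← evalHom_apply P hP f, aeval_algHom_apply, evalHom_apply]
  exact evalSeries_congr P fun j hj => (coeff_evalSeries_trunc hf hj).symm

/-- The chain rule. -/
theorem derivative_evalSeries {f : PowerSeries R} (hf : PowerSeries.constantCoeff f = 0)
    (g : PowerSeries R) :
    PowerSeries.derivative R (evalSeries f g) =
      evalSeries f (PowerSeries.derivative R g) * PowerSeries.derivative R f := by
  ext m
  rw [PowerSeries.coeff_derivative, coeff_evalSeries_trunc hf le_rfl,
    ← PowerSeries.coeff_derivative, Derivation.map_aeval, smul_eq_mul, PowerSeries.coeff_mul,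
    PowerSeries.coeff_mul]
  refine Finset.sum_congr rfl fun p hp => ?_
  rw [Finset.HasAntidiagonal.mem_antidiagonal] at hp
  rw [coeff_evalSeries hf (p := derivative (PowerSeries.trunc (m + 1 + 1) g))]
  intro j hj
  rw [Polynomial.coeff_derivative, PowerSeries.coeff_derivative, coeff_trunc_of_le (by omega)]

end Evaluation

/-! ### Exponential, logarithm and binomial series -/

section ExpLogUniv

variable {R : Type*} [CommRing R] [Algebra ℚ R]

theorem one_add_X_mul_derivative_log :
    (1 + PowerSeries.X) * PowerSeries.derivative R (PowerSeries.log R) = 1 := by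
  rw [PowerSeries.deriv_log]
  ext m
  cases m with
  | zero => simp [add_mul]
  | succ m =>
    rw [add_mul, one_mul, map_add, PowerSeries.coeff_succ_X_mul]
    simp [pow_succ, PowerSeries.coeff_one]

/-- `e ^ (p log (1 + x))` is the binomial series: both satisfy `(1 + x) y' = p y`. The
factor `p` is written as a constant series because for `R = K[X]` the notation `p • f` would refer to
the action that identifies the variable of `p` with that of the power series. -/
theorem coeff_exp_C_mul_log (p : R) (j : ℕ) :
    PowerSeries.coeff j (evalSeries (PowerSeries.C p * PowerSeries.log R) (PowerSeries.exp R)) =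
      algebraMap ℚ R (1 / (j.factorial : ℚ)) * ∏ a ∈ Finset.range j, (p - (a : R)) := by
  set y := evalSeries (PowerSeries.C p * PowerSeries.log R) (PowerSeries.exp R) with hy
  have hc : PowerSeries.constantCoeff (PowerSeries.C p * PowerSeries.log R) = 0 := by
    simp
  have hode : (1 + PowerSeries.X) * PowerSeries.derivative R y = p • y := by
    rw [hy, derivative_evalSeries hc, PowerSeries.derivative_exp,
      ← PowerSeries.smul_eq_C_mul, Derivation.map_smul,
      mul_left_comm, mul_smul_comm, one_add_X_mul_derivative_log, mul_smul_comm, mul_one]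
  have hrec (m : ℕ) : PowerSeries.coeff (m + 1) y * ((m : R) + 1) =
      (p - m) * PowerSeries.coeff m y := by
    have := congrArg (PowerSeries.coeff m) hode
    rw [add_mul, one_mul, map_add, PowerSeries.coeff_smul, PowerSeries.coeff_derivative,
      smul_eq_mul] at this
    cases m with
    | zero =>
      rw [PowerSeries.coeff_zero_X_mul] at this
      simpa using this
    | succ m =>
      rw [PowerSeries.coeff_succ_X_mul, PowerSeries.coeff_derivative] at this
      push_cast at this ⊢
      linear_combination this
  induction j with
  | zero =>
    rw [PowerSeries.coeff_zero_eq_constantCoeff_apply, hy, constantCoeff_evalSeries]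
    simp
  | succ j ih =>
    have hj : algebraMap ℚ R (1 / ((j : ℚ) + 1)) * ((j : R) + 1) = 1 := by
      have : ((j : R) + 1) = algebraMap ℚ R ((j : ℚ) + 1) := by simp
      rw [this, ← map_mul, one_div_mul_cancel (by positivity), map_one]
    have hfac : algebraMap ℚ R (1 / ((j + 1).factorial : ℚ)) =
        algebraMap ℚ R (1 / ((j : ℚ) + 1)) * algebraMap ℚ R (1 / (j.factorial : ℚ)) := by
      rw [← map_mul, Nat.factorial_succ]
      congr 1
      push_cast
      rw [one_div_mul_one_div]
    rw [Finset.prod_range_succ, hfac]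
    linear_combination (-PowerSeries.coeff (j + 1) y) * hj
      + algebraMap ℚ R (1 / ((j : ℚ) + 1)) * hrec j
      + algebraMap ℚ R (1 / ((j : ℚ) + 1)) * (p - j) * ih

theorem evalSeries_log_exp :
    evalSeries (PowerSeries.log R) (PowerSeries.exp R) = 1 + PowerSeries.X := by
  ext j
  have h := coeff_exp_C_mul_log (1 : R) j
  rw [map_one, one_mul] at h
  rw [h]
  match j with
  | 0 => simp
  | 1 => simp [PowerSeries.coeff_one]
  | j + 2 =>
    rw [Finset.prod_eq_zero (i := 1) (by simp) (by simp), mul_zero]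
    simp [PowerSeries.coeff_one, PowerSeries.coeff_X]

theorem constantCoeff_exp_sub_one :
    PowerSeries.constantCoeff (PowerSeries.exp R - 1) = 0 := by simp

theorem evalSeries_exp_sub_one_log :
    evalSeries (PowerSeries.exp R - 1) (PowerSeries.log R) = PowerSeries.X := by
  have h0 := constantCoeff_exp_sub_one (R := R)
  have hd : PowerSeries.derivative R (evalSeries (PowerSeries.exp R - 1) (PowerSeries.log R)) =
      1 := by
    rw [derivative_evalSeries h0, map_sub, PowerSeries.derivative_exp]
    have h1 := congrArg (evalHom (PowerSeries.exp R - 1) h0)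
      (one_add_X_mul_derivative_log (R := R))
    rw [map_mul, map_add, map_one, evalHom_apply, evalSeries_X h0, evalHom_apply] at h1
    simpa [mul_comm] using h1
  ext m
  cases m with
  | zero =>
    rw [PowerSeries.coeff_zero_eq_constantCoeff_apply, constantCoeff_evalSeries]
    simp
  | succ m =>
    have h := congrArg (PowerSeries.coeff m) hd
    rw [PowerSeries.coeff_derivative] at h
    have hm : ((m : R) + 1) * algebraMap ℚ R (1 / ((m : ℚ) + 1)) = 1 := by
      have : ((m : R) + 1) = algebraMap ℚ R ((m : ℚ) + 1) := by simp
      rw [this, ← map_mul, mul_one_div_cancel (by positivity), map_one]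
    have h2 := congrArg (· * algebraMap ℚ R (1 / ((m : ℚ) + 1))) h
    simp only [mul_assoc, hm, mul_one] at h2
    rw [h2, PowerSeries.coeff_one, PowerSeries.coeff_X]
    rcases Nat.eq_zero_or_pos m with rfl | hm
    · simp
    · rw [if_neg (by omega), if_neg (by omega), zero_mul]

end ExpLogUniv

section ExpLogOp

variable {K : Type*} [CommRing K] [Algebra ℚ K] {B : Type*} [Ring B] [Algebra K B]

theorem expSeries_eq (P : PowerSeries B) : expSeries K P = evalSeries P (PowerSeries.exp K) := by
  ext m
  simp [expSeries, evalSeries]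

theorem logSeries_eq (P : PowerSeries B) :
    logSeries K P = evalSeries (P - 1) (PowerSeries.log K) := by
  ext m
  rw [logSeries, evalSeries, PowerSeries.coeff_mk, PowerSeries.coeff_mk]
  refine Finset.sum_subset_zero_on_sdiff ?_ ?_ ?_
  · intro j hj
    rw [Finset.mem_Icc] at hj
    rw [Finset.mem_range]; omega
  · intro j hj
    simp only [Finset.mem_sdiff, Finset.mem_Icc, Finset.mem_range] at hj
    have : j = 0 := by omega
    simp [this]
  · intro j hj
    rw [Finset.mem_Icc] at hj
    rw [PowerSeries.coeff_log, if_neg (by omega)]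

theorem constantCoeff_sub_one {P : PowerSeries B} (hP : PowerSeries.constantCoeff P = 1) :
    PowerSeries.constantCoeff (P - 1) = 0 := by simp [hP]

theorem constantCoeff_logSeries (P : PowerSeries B) :
    PowerSeries.constantCoeff (logSeries K P) = 0 := by
  rw [logSeries_eq, constantCoeff_evalSeries]; simp

theorem expSeries_logSeries {P : PowerSeries B} (hP : PowerSeries.constantCoeff P = 1) :
    expSeries K (logSeries K P) = P := by
  have h := constantCoeff_sub_one hP
  rw [expSeries_eq, logSeries_eq, evalSeries_evalSeries h (by simp), evalSeries_log_exp,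
    ← evalHom_apply _ h, map_add, map_one, evalHom_apply, evalSeries_X h]
  abel

theorem logSeries_expSeries {d : PowerSeries B} (hd : PowerSeries.constantCoeff d = 0) :
    logSeries K (expSeries K d) = d := by
  have h : expSeries K d - 1 = evalSeries d (PowerSeries.exp K - 1) := by
    rw [← evalHom_apply d hd, map_sub, map_one, expSeries_eq, evalHom_apply]
  rw [logSeries_eq, h, evalSeries_evalSeries hd constantCoeff_exp_sub_one,
    evalSeries_exp_sub_one_log, evalSeries_X hd]

theorem expSeries_neg_mul_expSeries {d : PowerSeries B} (hd : PowerSeries.constantCoeff d = 0) :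
    expSeries K (-d) * expSeries K d = 1 := by
  have h : expSeries K (-d) = evalSeries d (PowerSeries.evalNegHom (PowerSeries.exp K)) := by
    ext m
    rw [expSeries_eq, evalSeries, evalSeries, PowerSeries.coeff_mk, PowerSeries.coeff_mk]
    refine Finset.sum_congr rfl fun j _ => ?_
    rw [PowerSeries.evalNegHom, PowerSeries.coeff_rescale]
    rcases Nat.even_or_odd j with hj | hj
    · simp [hj.neg_pow]
    · simp [hj.neg_pow]
  rw [h, expSeries_eq, ← evalHom_apply d hd, ← evalHom_apply d hd, ← map_mul, mul_comm,
    PowerSeries.exp_mul_exp_neg_eq_one, map_one]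

/-- The logarithm of an inverse. -/
theorem logSeries_of_mul_eq_one {P Q : PowerSeries B} (hP : PowerSeries.constantCoeff P = 1)
    (h : P * Q = 1) : logSeries K Q = -logSeries K P := by
  have h0 := constantCoeff_logSeries (K := K) P
  have h1 := expSeries_neg_mul_expSeries (K := K) h0
  rw [expSeries_logSeries hP] at h1
  have h2 : expSeries K (-logSeries K P) = Q := left_inv_eq_right_inv h1 h
  rw [← h2, logSeries_expSeries (by rw [map_neg, h0, neg_zero])]

end ExpLogOp

/-! ### Polynomial exponents -/

section PolyExp

variable {K : Type*} [CommRing K]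

/-- The polynomial `p(u)` acts on polynomials in the central variable `u` whose coefficients are
operators. -/
instance polynomialEndAlgebra {V : Type*} [AddCommGroup V] [Module K V] :
    Algebra K[X] (Module.End K V)[X] :=
  Polynomial.algebra K (Module.End K V)

variable {V : Type*} [AddCommGroup V] [Module K V]

theorem polynomialEndAlgebra_smul (p : K[X]) (T : (Module.End K V)[X]) :
    p • T = p.map (algebraMap K (Module.End K V)) * T := by
  rw [Algebra.smul_def]
  rfl

theorem C_smul_C (c : K) (b : Module.End K V) :
    (C c : K[X]) • (C b : (Module.End K V)[X]) = C (c • b) := by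
  rw [polynomialEndAlgebra_smul, Polynomial.map_C, ← C_mul, Algebra.smul_def]

theorem C_smul (c : K) (b : (Module.End K V)[X]) : (C c : K[X]) • b = c • b := by
  rw [polynomialEndAlgebra_smul, Polynomial.map_C, Algebra.smul_def]
  rfl

theorem X_smul (b : (Module.End K V)[X]) : (X : K[X]) • b = X * b := by
  rw [polynomialEndAlgebra_smul, Polynomial.map_X]

theorem map_C_evalSeries (P : PowerSeries (Module.End K V)) (f : PowerSeries K) :
    PowerSeries.map C (evalSeries P f) =
      evalSeries (PowerSeries.map C P) (PowerSeries.map C f : PowerSeries K[X]) := by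
  ext1 m
  simp only [evalSeries, PowerSeries.coeff_map, PowerSeries.coeff_mk, map_sum, ← map_pow, C_smul_C]

variable [Algebra ℚ K]

/-- The binomial series `∑ⱼ binom(p, j) x ^ j`. -/
def binomSeries (p : K[X]) : PowerSeries K[X] := PowerSeries.mk (binom p)

theorem evalSeries_C_mul_log_exp (p : K[X]) :
    evalSeries (PowerSeries.C p * PowerSeries.log K[X]) (PowerSeries.exp K[X]) = binomSeries p := by
  ext1 j
  rw [binomSeries, PowerSeries.coeff_mk, binom]
  exact coeff_exp_C_mul_log p j

theorem expSeries_eq_polynomial (Q : PowerSeries (Module.End K V)[X]) :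
    expSeries K Q = evalSeries Q (PowerSeries.exp K[X]) := by
  ext1 m
  rw [expSeries, evalSeries, PowerSeries.coeff_mk, PowerSeries.coeff_mk]
  refine Finset.sum_congr rfl fun j _ => ?_
  rw [PowerSeries.coeff_exp, ← C_smul]
  rfl

/-- `P ^ p = e ^ (p log P) = ∑ⱼ binom(p, j) (P - 1) ^ j` for a polynomial exponent `p`. -/
theorem expSeries_smul_logSeries {P : PowerSeries (Module.End K V)}
    (hP : PowerSeries.constantCoeff P = 1) (p : K[X]) :
    expSeries K (p • PowerSeries.map C (logSeries K P)) =
      evalSeries (PowerSeries.map C (P - 1)) (binomSeries p) := by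
  have h : PowerSeries.constantCoeff
      (PowerSeries.map (C : Module.End K V →+* (Module.End K V)[X]) (P - 1)) = 0 := by
    rw [← PowerSeries.coeff_zero_eq_constantCoeff_apply, PowerSeries.coeff_map,
      PowerSeries.coeff_zero_eq_constantCoeff_apply, constantCoeff_sub_one hP, map_zero]
  rw [expSeries_eq_polynomial, logSeries_eq, map_C_evalSeries, PowerSeries.map_log,
    ← evalSeries_C_mul, evalSeries_evalSeries h (by simp), evalSeries_C_mul_log_exp]

end PolyExp

/-! ### Sums over compositions -/

section Compositions

/-- A composition of `m + 1` is a composition of some `i ≤ m` followed by one further part. -/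
theorem sum_composition_succ {A : Type*} [AddCommMonoid A] (f : List ℕ → A) (m : ℕ) :
    ∑ I : Composition (m + 1), f I.blocks =
      ∑ p ∈ Finset.HasAntidiagonal.antidiagonal m,
        ∑ I : Composition p.1, f (I.blocks ++ [p.2 + 1]) := by
  have hext {x y : Σ p : ℕ × ℕ, Composition p.1} (h1 : x.1 = y.1)
      (h2 : x.2.blocks = y.2.blocks) : x = y := by
    obtain ⟨x1, x2⟩ := x
    obtain ⟨y1, y2⟩ := y
    obtain rfl : x1 = y1 := h1
    obtain rfl : x2 = y2 := Composition.ext h2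
    rfl
  rw [Finset.sum_sigma']
  symm
  refine Finset.sum_bij' (fun q hq => ⟨q.2.blocks ++ [q.1.2 + 1], ?_, ?_⟩)
    (fun I _ => ⟨(I.blocks.dropLast.sum, m - I.blocks.dropLast.sum),
      ⟨I.blocks.dropLast, fun h => I.blocks_pos (List.mem_of_mem_dropLast h), rfl⟩⟩)
    ?_ ?_ ?_ ?_ ?_
  · intro i hi
    rw [List.mem_append, List.mem_singleton] at hi
    rcases hi with hi | rfl
    · exact q.2.blocks_pos hi
    · exact Nat.succ_pos _
  · simp only [Finset.mem_sigma, Finset.HasAntidiagonal.mem_antidiagonal] at hq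
    rw [List.sum_append, q.2.blocks_sum, List.sum_singleton]
    omega
  · intro q hq
    exact Finset.mem_univ _
  · intro I _
    have hne : I.blocks ≠ [] := by
      intro h
      have := I.blocks_sum
      simp [h] at this
    have h1 : I.blocks.dropLast.sum + I.blocks.getLast hne = m + 1 := by
      have := I.blocks_sum
      rwa [← List.dropLast_append_getLast hne, List.sum_append, List.sum_singleton] at this
    have h2 : 0 < I.blocks.getLast hne := I.blocks_pos (List.getLast_mem hne)
    simp only [Finset.mem_sigma, Finset.HasAntidiagonal.mem_antidiagonal, Finset.mem_univ,
      and_true]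
    omega
  · intro q hq
    simp only [Finset.mem_sigma, Finset.HasAntidiagonal.mem_antidiagonal] at hq
    have hs := q.2.blocks_sum
    refine hext (Prod.ext ?_ ?_) ?_
    · simp [hs]
    · simp only [List.dropLast_concat]
      omega
    · simp
  · intro I _
    have hne : I.blocks ≠ [] := by
      intro h
      have := I.blocks_sum
      simp [h] at this
    have h1 : I.blocks.dropLast.sum + I.blocks.getLast hne = m + 1 := by
      have := I.blocks_sum
      rwa [← List.dropLast_append_getLast hne, List.sum_append, List.sum_singleton] at this
    have h2 : 0 < I.blocks.getLast hne := I.blocks_pos (List.getLast_mem hne)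
    apply Composition.ext
    have h3 : m - I.blocks.dropLast.sum + 1 = I.blocks.getLast hne := by omega
    simp only [h3, List.dropLast_append_getLast hne]
  · intro q hq
    rfl

theorem sum_composition_zero {A : Type*} [AddCommMonoid A] (f : List ℕ → A) :
    ∑ I : Composition 0, f I.blocks = f [] := by
  have h (I : Composition 0) : I.blocks = [] :=
    List.length_eq_zero_iff.mp (Nat.le_zero.mp I.length_le)
  rw [Fintype.sum_eq_single (Composition.ones 0) fun I hI =>
    (hI (Composition.ext ((h I).trans (h _).symm))).elim, h]

variable {B : Type*} [Ring B]

/-- The coefficients of `Q ^ j`: the sum of the words of the coefficients of `Q` over the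
compositions with `j` parts. -/
theorem coeff_pow_eq_sum_composition {Q : PowerSeries B} (hQ : PowerSeries.constantCoeff Q = 0)
    (j m : ℕ) :
    PowerSeries.coeff m (Q ^ j) = ∑ I : Composition m,
      if I.blocks.length = j then (I.blocks.map fun i => PowerSeries.coeff i Q).prod else 0 := by
  induction j generalizing m with
  | zero =>
    cases m with
    | zero =>
      rw [sum_composition_zero fun l =>
        if l.length = 0 then (l.map fun i => PowerSeries.coeff i Q).prod else 0]
      simp
    | succ m =>
      rw [sum_composition_succ fun l =>
        if l.length = 0 then (l.map fun i => PowerSeries.coeff i Q).prod else 0]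
      simp [PowerSeries.coeff_one]
  | succ j ih =>
    cases m with
    | zero =>
      rw [coeff_pow_eq_zero hQ (Nat.succ_pos j), sum_composition_zero fun l =>
        if l.length = j + 1 then (l.map fun i => PowerSeries.coeff i Q).prod else 0]
      simp
    | succ m =>
      rw [sum_composition_succ fun l =>
        if l.length = j + 1 then (l.map fun i => PowerSeries.coeff i Q).prod else 0,
        pow_succ, PowerSeries.coeff_mul, Finset.Nat.sum_antidiagonal_succ',
        PowerSeries.coeff_zero_eq_constantCoeff_apply, hQ, mul_zero, zero_add]
      refine Finset.sum_congr rfl fun p _ => ?_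
      rw [ih, Finset.sum_mul]
      refine Finset.sum_congr rfl fun I _ => ?_
      simp [ite_mul]

theorem piU_append (l : List ℕ) (a : ℕ) : piU (l ++ [a]) = piU l * (l.sum + a) := by
  rw [piU, piU, List.length_append, List.length_singleton, Finset.prod_range_succ]
  congr 1
  · refine Finset.prod_congr rfl fun j hj => ?_
    rw [Finset.mem_range] at hj
    rw [List.take_append_of_le_length (by omega)]
  · rw [List.take_of_length_le (by simp), List.sum_append, List.sum_singleton]

variable {K : Type*} [CommRing K] [Algebra ℚ K] [Algebra K B]

/-- The solution of the noncommutative linear differential equation `y' = y h` with initial value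
`y(0) = 1`, in terms of the coefficients of `h`. -/
theorem eq_sum_composition_of_recurrence {y h : ℕ → B} (h0 : y 0 = 1)
    (hrec : ∀ m, (m + 1) • y (m + 1) =
      ∑ p ∈ Finset.HasAntidiagonal.antidiagonal m, y p.1 * h p.2) (m : ℕ) :
    y m = ∑ I : Composition m, algebraMap ℚ K (1 / (piU I.blocks : ℚ)) •
      (I.blocks.map fun i => h (i - 1)).prod := by
  induction m using Nat.strong_induction_on with
  | _ m ih =>
    cases m with
    | zero =>
      rw [sum_composition_zero fun l => algebraMap ℚ K (1 / (piU l : ℚ)) •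
        (l.map fun i => h (i - 1)).prod]
      simp [piU, h0]
    | succ m =>
      rw [sum_composition_succ fun l => algebraMap ℚ K (1 / (piU l : ℚ)) •
        (l.map fun i => h (i - 1)).prod]
      have h1 : y (m + 1) = algebraMap ℚ K (1 / ((m : ℚ) + 1)) • ((m + 1) • y (m + 1)) := by
        rw [← Nat.cast_smul_eq_nsmul K, smul_smul]
        have : ((m + 1 : ℕ) : K) = algebraMap ℚ K ((m : ℚ) + 1) := by simp
        rw [this, ← map_mul, one_div_mul_cancel (by positivity), map_one, one_smul]
      rw [h1, hrec, Finset.smul_sum]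
      refine Finset.sum_congr rfl fun p hp => ?_
      rw [Finset.HasAntidiagonal.mem_antidiagonal] at hp
      rw [ih p.1 (by omega), Finset.sum_mul, Finset.smul_sum]
      refine Finset.sum_congr rfl fun I _ => ?_
      rw [smul_mul_assoc, smul_smul, ← map_mul, piU_append, I.blocks_sum, ← add_assoc, hp]
      simp [mul_comm]

/-- Distributivity for an ordered product of sums. -/
theorem prod_ofFn_sum : ∀ {r : ℕ} {ι : Fin r → Type} [∀ a, Fintype (ι a)] (f : ∀ a, ι a → B),
    (List.ofFn fun a => ∑ x, f a x).prod = ∑ x : ∀ a, ι a, (List.ofFn fun a => f a (x a)).prod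
  | 0, ι, _, f => by simp
  | r + 1, ι, _, f => by
    rw [List.ofFn_succ, List.prod_cons, prod_ofFn_sum, Finset.sum_mul_sum,
      ← Fintype.sum_prod_type', ← (Fin.consEquiv ι).sum_comp]
    refine Finset.sum_congr rfl fun x _ => ?_
    simp [Fin.consEquiv]

/-- Substituting `w i = ∑ v(I)`, the sum over the compositions `I` of `i`, into a sum of words in
`w` over compositions gives a sum over all ways of grouping the parts of a composition. -/
theorem sum_composition_word (c : ℕ → B) (v : List ℕ → B) (w : ℕ → B) {m : ℕ}
    (hw : ∀ i ≠ 0, w i = ∑ I : Composition i, v I.blocks) :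
    ∑ J : Composition m, c J.length * (J.blocks.map w).prod =
      ∑ I : Composition m, ∑ b : Composition I.length,
        c (I.gather b).length * ((I.blocks.splitWrtComposition b).map v).prod := by
  rw [Finset.sum_sigma']
  have h1 (J : Composition m) : c J.length * (J.blocks.map w).prod =
      ∑ y : ∀ a : Fin J.length, Composition (J.blocksFun a),
        c J.length * (List.ofFn fun a => v (y a).blocks).prod := by
    rw [← Finset.mul_sum, ← prod_ofFn_sum (fun (a : Fin J.length)
      (I : Composition (J.blocksFun a)) => v I.blocks), ← Composition.ofFn_blocksFun,
      List.map_ofFn]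
    congr 3
    funext a
    exact hw _ (Nat.one_le_iff_ne_zero.mp (J.one_le_blocksFun a))
  rw [Finset.sum_congr rfl fun J _ => h1 J, Finset.sum_sigma']
  refine (Fintype.sum_equiv (Composition.sigmaEquivSigmaPi m) _ _ ?_).symm
  rintro ⟨I, b⟩
  change _ = c (I.gather b).length *
    (List.ofFn fun a => v (I.sigmaCompositionAux b a).blocks).prod
  congr 2
  refine List.ext_getElem ?_ ?_
  · simp [Composition.length_gather]
  · intro i h2 h3
    simp [Composition.sigmaCompositionAux]

end Compositions

/-! ### Multiplication by a variable -/

section Variables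

variable {M R : Type*} [AddMonoid M] [Finset.HasAntidiagonal M] [CommRing R]

theorem FormalSeries.coeff_single_mul_add [IsLeftCancelAdd M] (a x : M) (w : FormalSeries M R) :
    (FormalSeries.single a * w).coeff (a + x) = w.coeff x := by
  rw [FormalSeries.mul_apply, Finset.sum_eq_single (a, x)]
  · simp [FormalSeries.single]
  · rintro ⟨b, c⟩ hbc hne
    rw [Finset.HasAntidiagonal.mem_antidiagonal] at hbc
    have hb : b ≠ a := by
      rintro rfl
      exact hne (Prod.ext rfl (add_left_cancel hbc))
    simp [FormalSeries.single, hb]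
  · intro h
    simp at h

theorem FormalSeries.coeff_single_mul_of_ne (a y : M) (w : FormalSeries M R)
    (h : ∀ x, a + x ≠ y) : (FormalSeries.single a * w).coeff y = 0 := by
  rw [FormalSeries.mul_apply]
  refine Finset.sum_eq_zero fun p hp => ?_
  rw [Finset.HasAntidiagonal.mem_antidiagonal] at hp
  have hb : p.1 ≠ a := by
    rintro rfl
    exact h p.2 hp
  simp [FormalSeries.single, hb]

theorem FormalSeries.sum_apply {ι : Type*} (s : Finset ι) (f : ι → FormalSeries M R) (x : M) :
    (∑ i ∈ s, f i).coeff x = ∑ i ∈ s, (f i).coeff x := by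
  classical
  induction s using Finset.induction_on with
  | empty => rfl
  | insert i s hi ih => rw [Finset.sum_insert hi, Finset.sum_insert hi, add_apply, ih]

instance (n : ℕ) : IsLeftCancelAdd (FreeAddMonoid (Fin n)) :=
  ⟨fun a _ _ h => FreeAddMonoid.toList.injective
    (List.append_cancel_left (as := FreeAddMonoid.toList a) h)⟩

instance (n : ℕ) : ∀ k : VarKind, IsLeftCancelAdd (Monomial n k)
  | .commutative => inferInstanceAs (IsLeftCancelAdd (Fin n →₀ ℕ))
  | .noncommutative => inferInstanceAs (IsLeftCancelAdd (FreeAddMonoid (Fin n)))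

variable {k : VarKind} {n : ℕ}

theorem Monomial.degree_add (x y : Monomial n k) : (x + y).degree = x.degree + y.degree := by
  cases k with
  | commutative =>
    change ∑ i, ((x : Fin n →₀ ℕ) + (y : Fin n →₀ ℕ)) i = ∑ i, (x : Fin n →₀ ℕ) i +
      ∑ i, (y : Fin n →₀ ℕ) i
    simp [Finset.sum_add_distrib]
  | noncommutative =>
    exact List.length_append

theorem Monomial.degree_var (i : Fin n) : (Monomial.var i : Monomial n k).degree = 1 := by
  cases k with
  | commutative =>
    change ∑ j, (Finsupp.single i 1 : Fin n →₀ ℕ) j = 1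
    simp [Finsupp.single_apply]
  | noncommutative => rfl

theorem Monomial.var_add_ne_zero (i : Fin n) (x : Monomial n k) : Monomial.var i + x ≠ 0 := by
  intro h
  have h1 := congrArg Monomial.degree h
  have h0 : (0 : Monomial n k).degree = 0 := by
    have := Monomial.degree_add (0 : Monomial n k) 0
    rw [add_zero] at this
    omega
  rw [Monomial.degree_add, Monomial.degree_var, h0] at h1
  omega

theorem Monomial.eq_zero_or_var_add (y : Monomial n k) :
    y = 0 ∨ ∃ i x, y = Monomial.var i + x := by
  cases k with
  | commutative =>
    by_cases h : (y : Fin n →₀ ℕ) = 0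
    · exact Or.inl h
    · obtain ⟨i, hi⟩ := Finsupp.ne_iff.mp h
      refine Or.inr ⟨i, (y : Fin n →₀ ℕ) - Finsupp.single i 1, ?_⟩
      change (y : Fin n →₀ ℕ) = Finsupp.single i 1 + (y - Finsupp.single i 1)
      rw [add_tsub_cancel_of_le]
      rw [Finsupp.single_le_iff]
      exact Nat.one_le_iff_ne_zero.mpr hi
  | noncommutative =>
    induction y using FreeAddMonoid.casesOn with
    | zero => exact Or.inl rfl
    | of_add i x => exact Or.inr ⟨i, x, rfl⟩

/-- Every series is a constant plus a combination of the variables; each nonconstant monomial is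
assigned to one of the variables that divide it from the left. -/
theorem exists_eq_const_add_sum (w : Ser k n R) :
    ∃ w' : Fin n → Ser k n R, w = w.coeff 0 • 1 + ∑ i, z i * w' i := by
  classical
  have hch : ∃ c : Monomial n k → Option (Fin n), ∀ y,
      (y = 0 → c y = none) ∧ (y ≠ 0 → ∃ i x, c y = some i ∧ y = Monomial.var i + x) := by
    refine Classical.axiomOfChoice (r := fun y (o : Option (Fin n)) =>
      (y = 0 → o = none) ∧ (y ≠ 0 → ∃ i x, o = some i ∧ y = Monomial.var i + x)) fun y => ?_
    rcases Monomial.eq_zero_or_var_add y with h | ⟨i, x, h⟩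
    · exact ⟨none, fun _ => rfl, fun h' => (h' h).elim⟩
    · exact ⟨some i, fun h' => (Monomial.var_add_ne_zero i x (h ▸ h')).elim,
        fun _ => ⟨i, x, rfl, h⟩⟩
  obtain ⟨c, hc⟩ := hch
  refine ⟨fun i => ⟨fun x => if c (Monomial.var i + x) = some i then
    w.coeff (Monomial.var i + x) else 0⟩, ?_⟩
  ext y
  rw [FormalSeries.add_apply, FormalSeries.smul_apply, FormalSeries.sum_apply,
    FormalSeries.one_apply]
  by_cases hy : y = 0
  · subst hy
    rw [if_pos rfl, mul_one, Finset.sum_eq_zero, add_zero]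
    exact fun i _ => FormalSeries.coeff_single_mul_of_ne _ _ _
      fun x => Monomial.var_add_ne_zero i x
  · obtain ⟨i, x, hi, hx⟩ := (hc y).2 hy
    rw [if_neg hy, mul_zero, zero_add, Finset.sum_eq_single i]
    · subst hx
      rw [z, FormalSeries.coeff_single_mul_add]
      exact (if_pos hi).symm
    · intro j _ hj
      by_cases h : ∃ x', Monomial.var j + x' = y
      · obtain ⟨x', rfl⟩ := h
        rw [z, FormalSeries.coeff_single_mul_add]
        refine if_neg ?_
        rw [hi]
        exact fun h => hj (Option.some_injective _ h).symm
      · exact FormalSeries.coeff_single_mul_of_ne _ _ _ fun x' hx' => h ⟨x', hx'⟩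
    · exact fun h => (h (Finset.mem_univ _)).elim

end Variables

/-! ### The derivations `[v ∂/∂z]` -/

section Derivations

variable {n : ℕ} {R : Type*} [CommRing R]

theorem commSeries_mul_comm (f g : FormalSeries (Fin n →₀ ℕ) R) : f * g = g * f := by
  ext x
  rw [FormalSeries.mul_apply, FormalSeries.mul_apply]
  refine Finset.sum_nbij' Prod.swap Prod.swap ?_ ?_ ?_ ?_ ?_ <;>
    simp [Finset.HasAntidiagonal.mem_antidiagonal, add_comm, mul_comm]

/-- The partial derivative `∂/∂zⱼ` for commuting variables. -/
def partialDer (j : Fin n) (f : FormalSeries (Fin n →₀ ℕ) R) : FormalSeries (Fin n →₀ ℕ) R :=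
  ⟨fun x => ((x j : R) + 1) * f.coeff (x + Finsupp.single j 1)⟩

theorem commDer_eq_sum (v : Fin n → FormalSeries (Fin n →₀ ℕ) R)
    (f : FormalSeries (Fin n →₀ ℕ) R) : commDer v f = ∑ j, v j * partialDer j f := by
  ext x
  rw [FormalSeries.sum_apply]
  rfl

theorem partialDer_var_mul (i j : Fin n) (w : FormalSeries (Fin n →₀ ℕ) R) :
    partialDer j (FormalSeries.single (Finsupp.single i 1) * w) =
      (if j = i then w else 0) + FormalSeries.single (Finsupp.single i 1) * partialDer j w := by
  ext x
  rw [FormalSeries.add_apply]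
  change ((x j : R) + 1) * _ = _
  by_cases hx : x i = 0
  · have h1 : (FormalSeries.single (Finsupp.single i 1) * partialDer j w).coeff x = 0 := by
      refine FormalSeries.coeff_single_mul_of_ne _ _ _ fun y hy => ?_
      rw [← hy] at hx
      simp at hx
    rw [h1, add_zero]
    by_cases hji : j = i
    · subst hji
      rw [if_pos rfl, add_comm x, FormalSeries.coeff_single_mul_add, hx]
      simp
    · rw [if_neg hji, FormalSeries.zero_apply, FormalSeries.coeff_single_mul_of_ne, mul_zero]
      intro y hy
      have := DFunLike.congr_fun hy i
      simp [hji, hx] at this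
  · obtain ⟨y, rfl⟩ : ∃ y, x = Finsupp.single i 1 + y := ⟨x - Finsupp.single i 1, by
      rw [add_tsub_cancel_of_le]
      rw [Finsupp.single_le_iff]
      exact Nat.one_le_iff_ne_zero.mpr hx⟩
    rw [add_assoc, FormalSeries.coeff_single_mul_add, FormalSeries.coeff_single_mul_add]
    change _ = _ + ((y j : R) + 1) * w.coeff (y + Finsupp.single j 1)
    by_cases hji : j = i
    · subst hji
      rw [if_pos rfl, add_comm (Finsupp.single j 1) y]
      simp only [Finsupp.add_apply, Finsupp.single_eq_same]
      push_cast
      ring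
    · rw [if_neg hji, FormalSeries.zero_apply]
      simp [Ne.symm hji]

/-- A factorization of a word that starts with the letter `a` either has an empty first factor, or
comes from a factorization of the rest of the word. -/
theorem sum_antidiagonal_of_add {A : Type*} [AddCommMonoid A] (a : Fin n)
    (x : FreeAddMonoid (Fin n)) (f : FreeAddMonoid (Fin n) × FreeAddMonoid (Fin n) → A) :
    ∑ p ∈ Finset.HasAntidiagonal.antidiagonal (FreeAddMonoid.of a + x), f p =
      f (0, FreeAddMonoid.of a + x) +
        ∑ p ∈ Finset.HasAntidiagonal.antidiagonal x, f (FreeAddMonoid.of a + p.1, p.2) := by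
  classical
  have hne (y : FreeAddMonoid (Fin n)) : FreeAddMonoid.of a + y ≠ 0 :=
    fun h => List.cons_ne_nil a y.toList h
  have h : Finset.HasAntidiagonal.antidiagonal (FreeAddMonoid.of a + x) =
      insert (0, FreeAddMonoid.of a + x) ((Finset.HasAntidiagonal.antidiagonal x).image
        fun p => (FreeAddMonoid.of a + p.1, p.2)) := by
    ext ⟨b, c⟩
    simp only [Finset.HasAntidiagonal.mem_antidiagonal, Finset.mem_insert, Finset.mem_image,
      Prod.mk.injEq, Prod.exists]
    constructor
    · intro hbc
      induction b using FreeAddMonoid.casesOn with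
      | zero => exact Or.inl ⟨rfl, by simpa using hbc⟩
      | of_add b y =>
        rw [add_assoc] at hbc
        obtain ⟨rfl, h2⟩ := List.cons.inj (show b :: (y + c).toList = a :: x.toList from hbc)
        exact Or.inr ⟨y, c, FreeAddMonoid.toList.injective h2, rfl, rfl⟩
    · rintro (⟨rfl, rfl⟩ | ⟨y, c', rfl, rfl, rfl⟩)
      · rw [zero_add]
      · rw [add_assoc]
  rw [h, Finset.sum_insert, Finset.sum_image]
  · intro p _ q _ hpq
    simp only [Prod.mk.injEq] at hpq
    exact Prod.ext (add_left_cancel hpq.1) hpq.2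
  · simp only [Finset.mem_image, Prod.mk.injEq, not_exists, not_and]
    intro p _ hp
    exact (hne _ hp).elim

theorem sum_antidiagonal_word_zero {A : Type*} [AddCommMonoid A]
    (f : FreeAddMonoid (Fin n) × FreeAddMonoid (Fin n) → A) :
    ∑ p ∈ Finset.HasAntidiagonal.antidiagonal (0 : FreeAddMonoid (Fin n)), f p = f (0, 0) := by
  have h : Finset.HasAntidiagonal.antidiagonal (0 : FreeAddMonoid (Fin n)) = {(0, 0)} := by
    ext ⟨b, c⟩
    simp only [Finset.HasAntidiagonal.mem_antidiagonal, Finset.mem_singleton, Prod.mk.injEq]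
    exact List.append_eq_nil_iff
  rw [h, Finset.sum_singleton]

theorem coeff_var_mul_of_add (i a : Fin n) (w : FormalSeries (FreeAddMonoid (Fin n)) R)
    (x : FreeAddMonoid (Fin n)) :
    (FormalSeries.single (FreeAddMonoid.of i) * w).coeff (FreeAddMonoid.of a + x) =
      if a = i then w.coeff x else 0 := by
  split_ifs with h
  · subst h
    exact FormalSeries.coeff_single_mul_add _ _ _
  · refine FormalSeries.coeff_single_mul_of_ne _ _ _ fun y hy => h ?_
    exact (List.cons.inj (show i :: y.toList = a :: x.toList from hy)).1.symm

theorem coeff_var_mul_word_zero (i : Fin n) (w : FormalSeries (FreeAddMonoid (Fin n)) R) :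
    (FormalSeries.single (FreeAddMonoid.of i) * w).coeff 0 = 0 :=
  FormalSeries.coeff_single_mul_of_ne _ _ _ fun y hy => List.cons_ne_nil i y.toList hy

theorem wordDer_var_mul (v : Fin n → FormalSeries (FreeAddMonoid (Fin n)) R) (i : Fin n)
    (w : FormalSeries (FreeAddMonoid (Fin n)) R) :
    wordDer v (FormalSeries.single (FreeAddMonoid.of i) * w) =
      v i * w + FormalSeries.single (FreeAddMonoid.of i) * wordDer v w := by
  -- The factorizations `x = a b c` with `a` empty contribute `vᵢ w`, the others `zᵢ [v ∂/∂z] w`.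
  have hfirst (x : FreeAddMonoid (Fin n)) :
      ∑ j, ∑ q ∈ Finset.HasAntidiagonal.antidiagonal x, (v j).coeff q.1 *
        (FormalSeries.single (FreeAddMonoid.of i) * w).coeff (0 + FreeAddMonoid.of j + q.2) =
      (v i * w).coeff x := by
    simp only [zero_add, coeff_var_mul_of_add]
    rw [Finset.sum_eq_single i, FormalSeries.mul_apply]
    · simp
    · intro j _ hj
      simp [hj]
    · simp
  ext x
  rw [FormalSeries.add_apply, ← hfirst]
  change ∑ j, ∑ p ∈ Finset.HasAntidiagonal.antidiagonal x,
    ∑ q ∈ Finset.HasAntidiagonal.antidiagonal p.2, (v j).coeff q.1 *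
      (FormalSeries.single (FreeAddMonoid.of i) * w).coeff (p.1 + FreeAddMonoid.of j + q.2) = _
  induction x using FreeAddMonoid.casesOn with
  | zero =>
    rw [coeff_var_mul_word_zero, add_zero]
    refine Finset.sum_congr rfl fun j _ => ?_
    rw [sum_antidiagonal_word_zero]
  | of_add a x =>
    rw [coeff_var_mul_of_add]
    simp only [sum_antidiagonal_of_add a x fun p => ∑ q ∈ Finset.HasAntidiagonal.antidiagonal p.2,
      (v _).coeff q.1 * (FormalSeries.single (FreeAddMonoid.of i) * w).coeff
        (p.1 + FreeAddMonoid.of _ + q.2), Finset.sum_add_distrib]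
    congr 1
    simp only [add_assoc, coeff_var_mul_of_add]
    split_ifs with h
    · simp only [← add_assoc]
      rfl
    · simp

variable {k : VarKind}

/-- The Leibniz rule for a product whose first factor is a variable. -/
theorem vecDer_var_mul (v : Fin n → Ser k n R) (i : Fin n) (w : Ser k n R) :
    vecDer v (z i * w) = v i * w + z i * vecDer v w := by
  cases k with
  | commutative =>
    change commDer v (FormalSeries.single (Finsupp.single i 1) * w) =
      v i * w + FormalSeries.single (Finsupp.single i 1) * commDer v w
    rw [commDer_eq_sum, commDer_eq_sum, Finset.mul_sum]
    simp only [partialDer_var_mul, mul_add, Finset.sum_add_distrib]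
    congr 1
    · simp
    · refine Finset.sum_congr rfl fun j _ => ?_
      rw [← mul_assoc, ← mul_assoc, commSeries_mul_comm (v j)]
  | noncommutative => exact wordDer_var_mul v i w

theorem vecDer_one (v : Fin n → Ser k n R) : vecDer v 1 = 0 := by
  cases k with
  | commutative =>
    change commDer v 1 = 0
    rw [commDer_eq_sum]
    refine Finset.sum_eq_zero fun j _ => ?_
    have : partialDer j (1 : FormalSeries (Fin n →₀ ℕ) R) = 0 := by
      ext x
      change ((x j : R) + 1) * _ = _
      rw [FormalSeries.one_apply, if_neg, mul_zero, FormalSeries.zero_apply]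
      intro h
      have := DFunLike.congr_fun h j
      simp at this
    rw [this, mul_zero]
  | noncommutative =>
    ext x
    change ∑ j, ∑ p ∈ Finset.HasAntidiagonal.antidiagonal x,
      ∑ q ∈ Finset.HasAntidiagonal.antidiagonal p.2, (v j).coeff q.1 *
        (1 : FormalSeries (FreeAddMonoid (Fin n)) R).coeff (p.1 + FreeAddMonoid.of j + q.2) = 0
    refine Finset.sum_eq_zero fun j _ => Finset.sum_eq_zero fun p _ =>
      Finset.sum_eq_zero fun q _ => ?_
    rw [FormalSeries.one_apply, if_neg, mul_zero]
    intro h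
    have := (List.append_eq_nil_iff.mp (List.append_eq_nil_iff.mp h).1).2
    exact List.cons_ne_nil j [] this

theorem vecDer_neg (v : Fin n → Ser k n R) (w : Ser k n R) :
    vecDer (fun i => -v i) w = -vecDer v w := by
  cases k with
  | commutative =>
    change commDer (fun i => -v i) w = -commDer v w
    simp [commDer_eq_sum]
  | noncommutative =>
    ext x
    change ∑ j, ∑ p ∈ Finset.HasAntidiagonal.antidiagonal x,
      ∑ q ∈ Finset.HasAntidiagonal.antidiagonal p.2, -(v j).coeff q.1 *
        w.coeff (p.1 + FreeAddMonoid.of j + q.2) =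
      -∑ j, ∑ p ∈ Finset.HasAntidiagonal.antidiagonal x,
        ∑ q ∈ Finset.HasAntidiagonal.antidiagonal p.2, (v j).coeff q.1 *
          w.coeff (p.1 + FreeAddMonoid.of j + q.2)
    simp only [neg_mul, Finset.sum_neg_distrib]

end Derivations

/-! ### Operators as power series in `t` -/

section Parameter

variable {k : VarKind} {n : ℕ} {K : Type*} [CommRing K]

/-- The inclusion of `K⟨⟨z⟩⟩` into `K[[t]]⟨⟨z⟩⟩` as a homomorphism of rings. -/
def constTHom : Ser k n K →+* Ser k n (PowerSeries K) where
  toFun := constT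
  map_one' := by
    ext1 x
    simp only [constT, FormalSeries.one_apply]
    split_ifs <;> simp
  map_mul' a b := by
    ext1 x
    simp [constT, FormalSeries.mul_apply]
  map_zero' := by
    ext1 x
    simp [constT, FormalSeries.zero_apply]
  map_add' a b := by
    ext1 x
    simp [constT, FormalSeries.add_apply]

theorem constTHom_apply (a : Ser k n K) : constTHom a = constT a := rfl

/-- The coefficient of `t ^ m` as an additive map. -/
def tCoeffHom (m : ℕ) : Ser k n (PowerSeries K) →+ Ser k n K where
  toFun := tCoeff m
  map_zero' := by
    ext x
    simp [tCoeff, FormalSeries.zero_apply]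
  map_add' a b := by
    ext x
    simp [tCoeff, FormalSeries.add_apply]

theorem tCoeffHom_apply (m : ℕ) (a : Ser k n (PowerSeries K)) :
    tCoeffHom m a = tCoeff m a := rfl

theorem tCoeff_constT (m : ℕ) (a : Ser k n K) : tCoeff m (constT a) = if m = 0 then a else 0 := by
  ext x
  simp only [tCoeff, constT, PowerSeries.coeff_C]
  split_ifs <;> rfl

theorem constT_z (i : Fin n) : constT (z i : Ser k n K) = z i := by
  ext1 x
  simp only [constT, z, FormalSeries.single]
  split_ifs <;> simp

theorem constT_smul_one (c : K) :
    constT (c • (1 : Ser k n K)) = PowerSeries.C c • (1 : Ser k n (PowerSeries K)) := by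
  ext1 x
  simp only [constT, FormalSeries.smul_apply, FormalSeries.one_apply]
  split_ifs <;> simp

theorem tCoeff_zero_mul (a b : Ser k n (PowerSeries K)) :
    tCoeff 0 (a * b) = tCoeff 0 a * tCoeff 0 b := by
  ext x
  simp [tCoeff, FormalSeries.mul_apply]

theorem tCoeff_X_smul_succ (m : ℕ) (a : Ser k n (PowerSeries K)) :
    tCoeff (m + 1) ((PowerSeries.X : PowerSeries K) • a) = tCoeff m a := by
  ext x
  simp only [tCoeff, FormalSeries.smul_apply, PowerSeries.coeff_succ_X_mul]

theorem tCoeff_X_smul_zero (a : Ser k n (PowerSeries K)) :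
    tCoeff 0 ((PowerSeries.X : PowerSeries K) • a) = 0 := by
  ext x
  simp only [tCoeff, FormalSeries.smul_apply, PowerSeries.coeff_zero_X_mul, FormalSeries.zero_apply]

/-- Every series in `K[[t]]⟨⟨z⟩⟩` is its constant term in `t` plus a multiple of `t`. -/
theorem exists_eq_constT_add_X_smul (a : Ser k n (PowerSeries K)) :
    ∃ b, a = constT (tCoeff 0 a) + (PowerSeries.X : PowerSeries K) • b ∧
      ∀ m, tCoeff m b = tCoeff (m + 1) a := by
  refine ⟨⟨fun x => PowerSeries.mk fun m => PowerSeries.coeff (m + 1) (a.coeff x)⟩, ?_, ?_⟩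
  · ext x m
    rw [FormalSeries.add_apply, FormalSeries.smul_apply]
    cases m with
    | zero => simp [constT, tCoeff]
    | succ m => simp [constT, tCoeff, PowerSeries.coeff_succ_X_mul]
  · intro m
    ext x
    simp [tCoeff]

theorem coeff_opSeries_apply (T : Module.End (PowerSeries K) (Ser k n (PowerSeries K)))
    (m : ℕ) (a : Ser k n K) : PowerSeries.coeff m (opSeries T) a = tCoeff m (T (constT a)) := by
  rw [opSeries, PowerSeries.coeff_mk]
  rfl

/-- A `K[[t]]`-linear operator is determined by its values on `K⟨⟨z⟩⟩`. -/
theorem tCoeff_map (T : Module.End (PowerSeries K) (Ser k n (PowerSeries K))) (m : ℕ)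
    (a : Ser k n (PowerSeries K)) :
    tCoeff m (T a) = ∑ p ∈ Finset.HasAntidiagonal.antidiagonal m,
      tCoeff p.1 (T (constT (tCoeff p.2 a))) := by
  induction m generalizing a with
  | zero =>
    obtain ⟨b, hb, -⟩ := exists_eq_constT_add_X_smul a
    conv_lhs => rw [hb]
    rw [map_add, map_smul, ← tCoeffHom_apply, map_add, tCoeffHom_apply, tCoeffHom_apply,
      tCoeff_X_smul_zero, add_zero]
    simp
  | succ m ih =>
    obtain ⟨b, hb, hm⟩ := exists_eq_constT_add_X_smul a
    conv_lhs => rw [hb]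
    rw [map_add, map_smul, ← tCoeffHom_apply, map_add, tCoeffHom_apply, tCoeffHom_apply,
      tCoeff_X_smul_succ, ih, Finset.Nat.sum_antidiagonal_succ']
    simp only [hm]

theorem opSeries_mul (S T : Module.End (PowerSeries K) (Ser k n (PowerSeries K))) :
    opSeries (S * T) = opSeries S * opSeries T := by
  ext1 m
  refine LinearMap.ext fun a => ?_
  rw [coeff_opSeries_apply, PowerSeries.coeff_mul, Module.End.mul_apply, tCoeff_map,
    LinearMap.sum_apply]
  refine Finset.sum_congr rfl fun p _ => ?_
  rw [Module.End.mul_apply, coeff_opSeries_apply, coeff_opSeries_apply]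

theorem opSeries_one : opSeries (1 : Module.End (PowerSeries K) (Ser k n (PowerSeries K))) = 1 := by
  ext1 m
  refine LinearMap.ext fun a => ?_
  rw [coeff_opSeries_apply, Module.End.one_apply, tCoeff_constT, PowerSeries.coeff_one]
  split_ifs <;> rfl

theorem opSeries_neg (T : Module.End (PowerSeries K) (Ser k n (PowerSeries K))) :
    opSeries (-T) = -opSeries T := by
  ext1 m
  refine LinearMap.ext fun a => ?_
  rw [map_neg, LinearMap.neg_apply, coeff_opSeries_apply, coeff_opSeries_apply,
    LinearMap.neg_apply, ← tCoeffHom_apply, map_neg, tCoeffHom_apply]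

/-! ### Density of the polynomials in `z` -/

/-- The `N`-th power of the ideal generated by `z` and `t`: the monomials `t ^ m x` that occur in
`a` satisfy `m + deg x ≥ N`. -/
def OrderGE (N : ℕ) (a : Ser k n (PowerSeries K)) : Prop :=
  ∀ (m : ℕ) (x : Monomial n k), m + x.degree < N → PowerSeries.coeff m (a.coeff x) = 0

theorem OrderGE.mul {N L : ℕ} {a b : Ser k n (PowerSeries K)} (ha : OrderGE N a)
    (hb : OrderGE L b) : OrderGE (N + L) (a * b) := by
  intro m x h
  rw [FormalSeries.mul_apply, map_sum]
  refine Finset.sum_eq_zero fun p hp => ?_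
  rw [PowerSeries.coeff_mul]
  refine Finset.sum_eq_zero fun q hq => ?_
  rw [Finset.HasAntidiagonal.mem_antidiagonal] at hp hq
  rw [← hp, ← hq, Monomial.degree_add] at h
  by_cases h1 : q.1 + p.1.degree < N
  · rw [ha _ _ h1, zero_mul]
  · rw [hb _ _ (by omega), mul_zero]

theorem OrderGE.sum {ι : Type*} {s : Finset ι} {N : ℕ} {a : ι → Ser k n (PowerSeries K)}
    (h : ∀ i ∈ s, OrderGE N (a i)) : OrderGE N (∑ i ∈ s, a i) := by
  intro m x hm
  rw [FormalSeries.sum_apply, map_sum]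
  exact Finset.sum_eq_zero fun i hi => h i hi m x hm

/-- An additive map that vanishes on constants and turns multiplication by `zᵢ` into
multiplication by an element of the ideal `(z, t)` is zero. This replaces a continuity assumption:
the values of the map lie in every power of `(z, t)`. -/
theorem eq_zero_of_map_var_mul (D : Ser k n K →+ Ser k n (PowerSeries K))
    {p : Fin n → Ser k n (PowerSeries K)} (hp : ∀ i, OrderGE 1 (p i))
    (h1 : ∀ c : K, D (c • 1) = 0) (hD : ∀ i w, D (z i * w) = p i * D w) (w : Ser k n K) :
    D w = 0 := by
  have h (N : ℕ) : ∀ w, OrderGE N (D w) := by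
    induction N with
    | zero => exact fun w m x hm => by omega
    | succ N ih =>
      intro w
      obtain ⟨w', hw⟩ := exists_eq_const_add_sum w
      rw [hw, map_add, h1, zero_add, map_sum]
      refine OrderGE.sum fun i _ => ?_
      rw [hD, add_comm N 1]
      exact (hp i).mul (ih _)
  ext x m
  exact h (m + x.degree + 1) w m x (by omega)

/-- An automorphism that fixes the variables modulo `t` is the identity modulo `t`. -/
theorem constantCoeff_opSeries_eq_one (Φ : Aut k n K) (h : ∀ i, tCoeff 0 (Φ (z i)) = z i) :
    PowerSeries.constantCoeff (opSeries Φ.toLinearMap) = 1 := by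
  refine LinearMap.ext fun w => ?_
  rw [← PowerSeries.coeff_zero_eq_constantCoeff_apply, coeff_opSeries_apply, Module.End.one_apply]
  let D : Ser k n K →+ Ser k n (PowerSeries K) :=
    (constTHom : Ser k n K →+* _).toAddMonoidHom.comp
      (((tCoeffHom 0).comp ((Φ : Ser k n (PowerSeries K) →+ Ser k n (PowerSeries K)).comp
        (constTHom : Ser k n K →+* _).toAddMonoidHom)) - AddMonoidHom.id _)
  have hDw (w) : D w = constTHom (tCoeff 0 (Φ (constT w)) - w) := rfl
  have h0 := eq_zero_of_map_var_mul D (p := fun i => z i) ?_ ?_ ?_ w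
  · rw [hDw] at h0
    have h2 := congrArg (tCoeff 0) h0
    rw [constTHom_apply, tCoeff_constT, if_pos rfl, ← tCoeffHom_apply 0 0, map_zero] at h2
    exact sub_eq_zero.mp h2
  · intro i m x hmx
    have hx : x ≠ Monomial.var i := by
      rintro rfl
      rw [Monomial.degree_var] at hmx
      omega
    simp [z, FormalSeries.single, hx]
  · intro c
    rw [hDw, constT_smul_one, map_smul, map_one, ← constT_smul_one, tCoeff_constT, if_pos rfl,
      sub_self, map_zero]
  · intro i w
    rw [hDw, hDw, ← constTHom_apply (z i * w), map_mul, constTHom_apply (z i), constTHom_apply w,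
      constT_z,
      map_mul, tCoeff_zero_mul, h, ← mul_sub, map_mul,
      constTHom_apply (z i), constT_z, constTHom_apply]

theorem tDeriv_mul (a b : Ser k n (PowerSeries K)) :
    tDeriv (a * b) = tDeriv a * b + a * tDeriv b := by
  ext1 x
  rw [FormalSeries.add_apply, FormalSeries.mul_apply, FormalSeries.mul_apply]
  change PowerSeries.derivative K (∑ p ∈ _, _) = _
  rw [map_sum, ← Finset.sum_add_distrib]
  refine Finset.sum_congr rfl fun p _ => ?_
  rw [Derivation.leibniz, smul_eq_mul, smul_eq_mul, add_comm, mul_comm (b.coeff p.2)]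
  rfl

/-- `∂/∂t` as an additive map. -/
def tDerivHom : Ser k n (PowerSeries K) →+ Ser k n (PowerSeries K) where
  toFun := tDeriv
  map_zero' := by
    ext1 x
    exact map_zero (PowerSeries.derivative K)
  map_add' a b := by
    ext1 x
    exact map_add (PowerSeries.derivative K) _ _

theorem tDerivHom_apply (a : Ser k n (PowerSeries K)) : tDerivHom a = tDeriv a := rfl

theorem tDeriv_constT (a : Ser k n K) : tDeriv (constT a) = 0 := by
  ext1 x
  exact PowerSeries.derivative_C

theorem tCoeff_tDeriv (m : ℕ) (a : Ser k n (PowerSeries K)) :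
    tCoeff m (tDeriv a) = (m + 1) • tCoeff (m + 1) a := by
  have h (j : ℕ) (b : Ser k n K) (x) : (j • b).coeff x = j • b.coeff x := by
    induction j with
    | zero => simp [FormalSeries.zero_apply]
    | succ j ih => rw [succ_nsmul, succ_nsmul, FormalSeries.add_apply, ih]
  ext x
  rw [h, nsmul_eq_mul, mul_comm]
  push_cast
  exact PowerSeries.coeff_derivative _ _

/-- The differential equation of an automorphism: on series that do not involve `t`,
`∂/∂t ∘ Φ = Φ ∘ [Φ⁻¹(∂Φ(z)/∂t) ∂/∂z]`. Both sides satisfy the Leibniz rule with respect to `Φ` and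
agree on the variables. -/
theorem tDeriv_aut (Φ : Aut k n K) (hΦ : ∀ i, tCoeff 0 (Φ (z i)) = z i) (w : Ser k n K) :
    tDeriv (Φ (constT w)) = Φ (vecDer (fun i => Φ.symm (tDeriv (Φ (z i)))) (constT w)) := by
  set v : Fin n → Ser k n (PowerSeries K) := fun i => Φ.symm (tDeriv (Φ (z i))) with hv
  let Φa : Ser k n (PowerSeries K) →+ Ser k n (PowerSeries K) := Φ
  let D : Ser k n K →+ Ser k n (PowerSeries K) :=
    (tDerivHom.comp (Φa.comp (constTHom : Ser k n K →+* _).toAddMonoidHom)) -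
      (Φa.comp ((vecDer v).toAddMonoidHom.comp (constTHom : Ser k n K →+* _).toAddMonoidHom))
  have hDw (w) : D w = tDeriv (Φ (constT w)) - Φ (vecDer v (constT w)) := rfl
  refine sub_eq_zero.mp ((hDw w).symm.trans
    (eq_zero_of_map_var_mul D (p := fun i => Φ (z i)) ?_ ?_ ?_ w))
  · intro i m x hmx
    have hm : m = 0 := by omega
    have hx : x ≠ Monomial.var i := by
      rintro rfl
      rw [Monomial.degree_var] at hmx
      omega
    have := congrArg (fun a => a.coeff x) (hΦ i)
    subst hm
    simp only [z, FormalSeries.single, if_neg hx] at this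
    exact this
  · intro c
    rw [hDw, constT_smul_one, map_smul, map_smul, map_one, vecDer_one, smul_zero, map_zero,
      sub_zero, ← constT_smul_one, tDeriv_constT]
  · intro i w
    rw [hDw, hDw, ← constTHom_apply (z i * w), map_mul, constTHom_apply (z i), constTHom_apply w,
      constT_z,
      map_mul, tDeriv_mul, vecDer_var_mul, map_add, map_mul, map_mul, hv]
    simp only [AlgEquiv.apply_symm_apply]
    noncomm_ring

/-- The same differential equation in terms of coefficients: `y' = y h`. -/
theorem coeff_opSeries_recurrence (Φ : Aut k n K) (hΦ : ∀ i, tCoeff 0 (Φ (z i)) = z i) (m : ℕ) :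
    (m + 1) • PowerSeries.coeff (m + 1) (opSeries Φ.toLinearMap) =
      ∑ p ∈ Finset.HasAntidiagonal.antidiagonal m,
        PowerSeries.coeff p.1 (opSeries Φ.toLinearMap) *
          PowerSeries.coeff p.2 (opSeries (vecDer fun i => Φ.symm (tDeriv (Φ (z i))))) := by
  rw [← PowerSeries.coeff_mul, ← opSeries_mul]
  refine LinearMap.ext fun w => ?_
  rw [LinearMap.smul_apply, coeff_opSeries_apply, coeff_opSeries_apply, ← tCoeff_tDeriv]
  exact congrArg (tCoeff m) (tDeriv_aut Φ hΦ w)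

end Parameter

/-! ### The system of an automorphism -/

section System

variable {k : VarKind} {n : ℕ} {K : Type*} [CommRing K] {α : ℕ} {F : Aut k n K}

theorem opSeries_symm_mul (F : Aut k n K) :
    opSeries F.symm.toLinearMap * opSeries F.toLinearMap = 1 := by
  rw [← opSeries_mul, ← opSeries_one]
  congr 1
  exact LinearMap.ext fun a => F.symm_apply_apply a

theorem tCoeff_zero_z (i : Fin n) : tCoeff 0 (z i : Ser k n (PowerSeries K)) = z i := by
  rw [← constT_z, tCoeff_constT, if_pos rfl]

theorem MemAut.tCoeff_zero (hF : MemAut α F) (i : Fin n) : tCoeff 0 (F (z i)) = z i := by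
  have h : F (z i) = z i - Hpart F i := by rw [Hpart, sub_sub_cancel]
  rw [h, ← tCoeffHom_apply, map_sub, tCoeffHom_apply, tCoeffHom_apply, tCoeff_zero_z]
  have : tCoeff 0 (Hpart F i) = 0 := by
    ext x
    exact (PowerSeries.coeff_zero_eq_constantCoeff_apply _).trans (hF.at_zero i x)
  rw [this, sub_zero]

theorem MemAut.constantCoeff_opSeries (hF : MemAut α F) :
    PowerSeries.constantCoeff (opSeries F.toLinearMap) = 1 :=
  constantCoeff_opSeries_eq_one F hF.tCoeff_zero

theorem MemAut.constantCoeff_gSeries (hF : MemAut α F) :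
    PowerSeries.constantCoeff (gSeries F) = 1 := by
  have h := congrArg PowerSeries.constantCoeff (opSeries_symm_mul F)
  rw [map_mul, hF.constantCoeff_opSeries, mul_one, map_one] at h
  exact h

theorem MemAut.tCoeff_zero_symm (hF : MemAut α F) (i : Fin n) :
    tCoeff 0 (F.symm (z i)) = z i := by
  have h := LinearMap.congr_fun hF.constantCoeff_gSeries (z i)
  rw [← PowerSeries.coeff_zero_eq_constantCoeff_apply, gSeries, coeff_opSeries_apply, constT_z] at h
  exact h

theorem tDeriv_z (i : Fin n) : tDeriv (z i : Ser k n (PowerSeries K)) = 0 := by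
  rw [← constT_z, tDeriv_constT]

/-- `g' = g h`. -/
theorem MemAut.gSeries_recurrence (hF : MemAut α F) (m : ℕ) :
    (m + 1) • PowerSeries.coeff (m + 1) (gSeries F) =
      ∑ p ∈ Finset.HasAntidiagonal.antidiagonal m,
        PowerSeries.coeff p.1 (gSeries F) * PowerSeries.coeff p.2 (hSeries F) := by
  have h := coeff_opSeries_recurrence F.symm hF.tCoeff_zero_symm m
  have h1 (i : Fin n) : tDeriv (Mpart F i) = tDeriv (F.symm (z i)) := by
    rw [Mpart, ← tDerivHom_apply, map_sub, tDerivHom_apply, tDerivHom_apply, tDeriv_z, sub_zero]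
  simp only [hSeries, h1]
  exact h

/-- `f(-t)' = -f(-t) m(t)`. -/
theorem MemAut.opSeries_recurrence (hF : MemAut α F) (m : ℕ) :
    (m + 1) • PowerSeries.coeff (m + 1) (opSeries F.toLinearMap) =
      ∑ p ∈ Finset.HasAntidiagonal.antidiagonal m,
        PowerSeries.coeff p.1 (opSeries F.toLinearMap) * -PowerSeries.coeff p.2 (mSeries F) := by
  have h := coeff_opSeries_recurrence F hF.tCoeff_zero m
  have h1 (i : Fin n) : F.symm (tDeriv (F (z i))) = -F.symm (tDeriv (Hpart F i)) := by
    rw [Hpart, ← tDerivHom_apply, ← tDerivHom_apply, map_sub, tDerivHom_apply (z i), tDeriv_z,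
      zero_sub, map_neg, neg_neg]
  have h2 : vecDer (fun i => F.symm (tDeriv (F (z i)))) =
      -vecDer fun i => F.symm (tDeriv (Hpart F i)) := by
    simp only [h1]
    exact LinearMap.ext fun w => vecDer_neg _ w
  rw [h, h2, opSeries_neg]
  simp only [map_neg, mSeries]

end System

/-! ### Expansions of the flow -/

section Flow

variable {k : VarKind} {n : ℕ} {K : Type*} [CommRing K]

theorem coeff_applyU (P : PowerSeries (Module.End K (Ser k n K))[X]) (a : Ser k n K)
    (x : Monomial n k) (m j : ℕ) :
    (PowerSeries.coeff m ((applyU P a).coeff x)).coeff j =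
      (((PowerSeries.coeff m P).coeff j) a).coeff x := by
  rw [applyU, PowerSeries.coeff_mk, Polynomial.sum, finsetSum_coeff]
  simp only [coeff_monomial, Finset.sum_ite_eq']
  split_ifs with h
  · rfl
  · rw [notMem_support_iff.mp h]
    rfl

/-- The expansion `∑ⱼ fⱼ(u) Q ^ j z = z + ∑ f_{ℓ(I)}(u) t ^ |I| Q ^ I z` over compositions. -/
theorem applyU_evalSeries {Q : PowerSeries (Module.End K (Ser k n K))}
    (hQ : PowerSeries.constantCoeff Q = 0) {f : PowerSeries K[X]}
    (hf : PowerSeries.constantCoeff f = 1) (i : Fin n) :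
    applyU (evalSeries (PowerSeries.map C Q) f) (z i) =
      z i + compSum (fun I => PowerSeries.coeff I.length f)
        (fun m => PowerSeries.coeff m Q) (z i) := by
  ext x m l
  rw [coeff_applyU, evalSeries, PowerSeries.coeff_mk, finsetSum_coeff, LinearMap.sum_apply,
    FormalSeries.sum_apply, FormalSeries.add_apply, map_add, coeff_add, compSum,
    PowerSeries.coeff_mk]
  have hterm (j : ℕ) : (((PowerSeries.coeff j f •
      PowerSeries.coeff m (PowerSeries.map (C : Module.End K (Ser k n K) →+* _) Q ^ j)).coeff l)
        (z i)).coeff x = (PowerSeries.coeff j f).coeff l *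
          ((PowerSeries.coeff m (Q ^ j)) (z i)).coeff x := by
    rw [← map_pow, PowerSeries.coeff_map, polynomialEndAlgebra_smul, coeff_mul_C, coeff_map]
    rfl
  simp only [hterm]
  cases m with
  | zero =>
    rw [if_pos rfl, zero_add, Finset.sum_range_one, pow_zero, PowerSeries.coeff_zero_one,
      PowerSeries.coeff_zero_eq_constantCoeff_apply, hf, coeff_zero, add_zero]
    simp only [z, FormalSeries.single, Module.End.one_apply]
    split_ifs <;> simp
  | succ m =>
    have hz : PowerSeries.coeff (m + 1) ((z i : Ser k n (PowerSeries K[X])).coeff x) = 0 := by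
      simp only [z, FormalSeries.single]
      split_ifs <;> simp [PowerSeries.coeff_one]
    rw [hz, coeff_zero, zero_add, if_neg (Nat.succ_ne_zero m), finsetSum_coeff]
    simp only [coeff_pow_eq_sum_composition hQ, LinearMap.sum_apply, FormalSeries.sum_apply,
      Finset.mul_sum]
    rw [Finset.sum_comm]
    refine Finset.sum_congr rfl fun I _ => ?_
    rw [Finset.sum_eq_single I.length]
    · rw [if_pos rfl, coeff_mul_C]
      rfl
    · intro j _ hj
      rw [if_neg (Ne.symm hj)]
      simp [FormalSeries.zero_apply]
    · intro h
      exact (h (Finset.mem_range.mpr (Nat.lt_succ_of_le I.length_le))).elim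

theorem compSum_congr {c c' : ∀ {m : ℕ}, Composition m → K[X]}
    {w w' : ℕ → Module.End K (Ser k n K)} {a : Ser k n K}
    (h : ∀ m ≠ 0, ∀ x, ∑ I : Composition m, c I * C ((word w I a).coeff x) =
      ∑ I : Composition m, c' I * C ((word w' I a).coeff x)) :
    compSum c w a = compSum c' w' a := by
  ext1 x
  simp only [compSum]
  congr 1
  funext m
  split_ifs with hm
  · rfl
  · exact h m hm x

/-- If the parts of two words differ by scalars, so do the words. -/
theorem word_eq_smul {w w' : ℕ → Module.End K (Ser k n K)} {r : ℕ → K}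
    (l : List ℕ) (h : ∀ i ∈ l, w i = r i • w' i) :
    (l.map w).prod = (l.map r).prod • (l.map w').prod := by
  induction l with
  | nil => simp
  | cons i l ih =>
    rw [List.map_cons, List.map_cons, List.map_cons, List.prod_cons, List.prod_cons,
      List.prod_cons, h i List.mem_cons_self,
      ih fun j hj => h j (List.mem_cons_of_mem _ hj), smul_mul_smul_comm]

theorem word_sub_one (Q : PowerSeries (Module.End K (Ser k n K))) {m : ℕ} (I : Composition m) :
    word (fun i => PowerSeries.coeff i (Q - 1)) I = word (fun i => PowerSeries.coeff i Q) I := by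
  rw [word, word]
  congr 1
  refine List.map_congr_left fun i hi => ?_
  rw [map_sub, PowerSeries.coeff_one, if_neg (I.blocks_pos hi).ne', sub_zero]

variable [Algebra ℚ K]

theorem expSeries_smul_eq (p : K[X]) (Q : PowerSeries (Module.End K (Ser k n K))[X]) :
    expSeries K (p • Q) = evalSeries Q (PowerSeries.mk fun j =>
      C (algebraMap ℚ K (1 / (j.factorial : ℚ))) * p ^ j) := by
  rw [expSeries_eq_polynomial]
  ext1 m
  rw [evalSeries, evalSeries, PowerSeries.coeff_mk, PowerSeries.coeff_mk]
  refine Finset.sum_congr rfl fun j _ => ?_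
  rw [_root_.smul_pow, PowerSeries.coeff_smul, smul_smul, PowerSeries.coeff_mk, PowerSeries.coeff_exp]
  rfl

theorem constantCoeff_binomSeries (p : K[X]) :
    PowerSeries.constantCoeff (binomSeries p) = 1 := by
  rw [← PowerSeries.coeff_zero_eq_constantCoeff_apply, binomSeries, PowerSeries.coeff_mk]
  simp [binom]

theorem flow_eq (F : Aut k n K) (i : Fin n) : flow F i =
    applyU (expSeries K ((-X : K[X]) • PowerSeries.map C (dSeries F))) (z i) := by
  rw [flow]
  congr 2
  ext1 m
  rw [map_neg, PowerSeries.coeff_C_mul, PowerSeries.coeff_smul, neg_smul, X_smul]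

/-- The expansion of `P ^ p z` for a polynomial exponent `p`. -/
theorem applyU_power {P : PowerSeries (Module.End K (Ser k n K))}
    (hP : PowerSeries.constantCoeff P = 1) (p : K[X]) (i : Fin n) :
    applyU (expSeries K (p • PowerSeries.map C (logSeries K P))) (z i) =
      z i + compSum (fun I => binom p I.length) (fun m => PowerSeries.coeff m P) (z i) := by
  rw [expSeries_smul_logSeries hP, applyU_evalSeries (constantCoeff_sub_one hP)
    (constantCoeff_binomSeries p)]
  refine congrArg (z i + ·) (compSum_congr fun m _ x =>
    Finset.sum_congr rfl fun I _ => ?_)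
  rw [word_sub_one, binomSeries, PowerSeries.coeff_mk]

/-- The passage from the coefficients of the solution of `y' = y h` to those of `h`. -/
theorem compSum_binom_eq_compSum_coarseSum {y h : ℕ → Module.End K (Ser k n K)} (h0 : y 0 = 1)
    (hrec : ∀ m, (m + 1) • y (m + 1) =
      ∑ p ∈ Finset.HasAntidiagonal.antidiagonal m, y p.1 * h p.2) (p : K[X]) (a : Ser k n K) :
    compSum (fun I => binom p I.length) y a =
      compSum (fun I => coarseSum p I) (fun m => h (m - 1)) a := by
  refine compSum_congr fun m _ x => ?_
  ext l
  -- For each power of `u` the identity is one between sums of operators.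
  have key := sum_composition_word (m := m)
    (fun j => algebraMap K (Module.End K (Ser k n K)) ((binom p j).coeff l))
    (fun L => algebraMap ℚ K (1 / (piU L : ℚ)) • (L.map fun i => h (i - 1)).prod) y
    (fun i _ => eq_sum_composition_of_recurrence h0 hrec i)
  have key2 := congrArg (fun T : Module.End K (Ser k n K) => (T a).coeff x) key
  simp only [LinearMap.sum_apply, FormalSeries.sum_apply, Module.End.mul_apply,
    Module.algebraMap_end_apply, FormalSeries.smul_apply] at key2
  simp only [finsetSum_coeff, coeff_mul_C]
  refine key2.trans (Finset.sum_congr rfl fun I _ => ?_)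
  rw [coarseSum, finsetSum_coeff, Finset.sum_mul]
  refine Finset.sum_congr rfl fun b _ => ?_
  have hprod (L : List (List ℕ)) :
      (L.map fun L => algebraMap ℚ K (1 / (piU L : ℚ)) • (L.map fun i => h (i - 1)).prod).prod =
        algebraMap ℚ K (1 / ((L.map piU).prod : ℚ)) •
          (L.flatten.map fun i => h (i - 1)).prod := by
    induction L with
    | nil => simp
    | cons L L' ih =>
      rw [List.map_cons, List.prod_cons, ih, smul_mul_smul_comm, ← map_mul, List.map_cons,
        List.prod_cons, List.flatten_cons, List.map_append, List.prod_append, one_div_mul_one_div]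
      push_cast
      rfl
  rw [hprod, List.flatten_splitWrtComposition, LinearMap.smul_apply, FormalSeries.smul_apply,
    coeff_C_mul, piURel, word]
  ring


variable {α : ℕ} {F : Aut k n K}

theorem MemAut.flow_eq_gSeries (hF : MemAut α F) (i : Fin n) :
    flow F i = z i + compSum (fun I => binom (-X) I.length)
      (fun m => PowerSeries.coeff m (gSeries F)) (z i) := by
  rw [flow_eq, dSeries, applyU_power hF.constantCoeff_gSeries]

theorem MemAut.flow_eq_opSeries (hF : MemAut α F) (i : Fin n) :
    flow F i = z i + compSum (fun I => binom X I.length)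
      (fun m => PowerSeries.coeff m (opSeries F.toLinearMap)) (z i) := by
  rw [flow_eq, dSeries, ← applyU_power hF.constantCoeff_opSeries, ← neg_eq_iff_eq_neg.mpr
    (logSeries_of_mul_eq_one hF.constantCoeff_gSeries (opSeries_symm_mul F)), map_neg, smul_neg,
    neg_smul, neg_neg]

theorem flow_eq_phi (F : Aut k n K) (i : Fin n) :
    flow F i = z i + compSum (fun I =>
      C (algebraMap ℚ K (1 / (sp I.blocks : ℚ))) * (-X) ^ I.length) (phi F) (z i) := by
  have hd : PowerSeries.constantCoeff (dSeries F) = 0 := constantCoeff_logSeries _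
  have h := applyU_evalSeries hd (f := PowerSeries.mk fun j =>
    C (algebraMap ℚ K (1 / (j.factorial : ℚ))) * (-X) ^ j)
    (by rw [← PowerSeries.coeff_zero_eq_constantCoeff_apply, PowerSeries.coeff_mk]; simp) i
  rw [flow_eq, expSeries_smul_eq, h]
  refine congrArg (z i + ·) (compSum_congr fun m _ x =>
    Finset.sum_congr rfl fun I _ => ?_)
  rw [PowerSeries.coeff_mk, word, word, word_eq_smul (w := phi F) (r := fun i : ℕ => (i : K))
    (w' := fun m => PowerSeries.coeff m (dSeries F)) I.blocks
    fun i _ => (Nat.cast_smul_eq_nsmul K i _).symm]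
  have h1 : algebraMap ℚ K (1 / (sp I.blocks : ℚ)) * (I.blocks.map fun i : ℕ => (i : K)).prod =
      algebraMap ℚ K (1 / (I.length.factorial : ℚ)) := by
    have h2 : (I.blocks.map fun i : ℕ => (i : K)).prod = algebraMap ℚ K (I.blocks.prod : ℚ) := by
      rw [map_natCast, Nat.cast_list_prod]
    have h3 : (I.blocks.prod : ℚ) ≠ 0 := by
      rw [Nat.cast_ne_zero]
      exact List.prod_ne_zero fun h => (I.blocks_pos h).ne' rfl
    rw [h2, ← map_mul, sp, piProd]
    congr 1
    rw [Composition.blocks_length, Nat.cast_mul, one_div, one_div, mul_inv, mul_assoc,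
      inv_mul_cancel₀ h3, mul_one]
  rw [LinearMap.smul_apply, FormalSeries.smul_apply, ← h1, map_mul, map_mul]
  ring

theorem MemAut.flow_eq_lam (hF : MemAut α F) (i : Fin n) :
    flow F i = z i + compSum (fun {m} I => (-1) ^ m * binom X I.length) (lam F) (z i) := by
  rw [hF.flow_eq_opSeries]
  refine congrArg (z i + ·) (compSum_congr fun m _ x =>
    Finset.sum_congr rfl fun I _ => ?_)
  have h1 (i : ℕ) : PowerSeries.coeff i (opSeries F.toLinearMap) = (-1 : K) ^ i • lam F i := by
    rw [lam, fSeries, PowerSeries.coeff_mk]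
    rcases Nat.even_or_odd i with hi | hi
    · rw [hi.neg_one_pow, hi.neg_one_pow, one_mul, one_smul]
    · rw [hi.neg_one_pow, hi.neg_one_pow, neg_one_smul, neg_one_mul, neg_neg]
  have h2 (l : List ℕ) : (l.map fun i => (-1 : K) ^ i).prod = (-1) ^ l.sum := by
    induction l with
    | nil => simp
    | cons i l ih => rw [List.map_cons, List.prod_cons, ih, List.sum_cons, pow_add]
  rw [word, word, word_eq_smul I.blocks fun i _ => h1 i, h2, I.blocks_sum,
    LinearMap.smul_apply, FormalSeries.smul_apply, map_mul, map_pow, map_neg,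
    map_one]
  ring

theorem MemAut.flow_eq_psi (hF : MemAut α F) (i : Fin n) :
    flow F i = z i + compSum (fun I => coarseSum (-X) I) (psi F) (z i) := by
  have h0 : PowerSeries.coeff 0 (gSeries F) = 1 := by
    rw [PowerSeries.coeff_zero_eq_constantCoeff_apply, hF.constantCoeff_gSeries]
  have h := compSum_binom_eq_compSum_coarseSum (y := fun m => PowerSeries.coeff m (gSeries F))
    (h := fun m => PowerSeries.coeff m (hSeries F)) h0 hF.gSeries_recurrence (-X) (z i)
  have hpsi : psi F = fun m => PowerSeries.coeff (m - 1) (hSeries F) := funext fun m => by rw [psi]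
  rw [hpsi, ← h]
  exact hF.flow_eq_gSeries i

theorem MemAut.flow_eq_xi (hF : MemAut α F) (i : Fin n) :
    flow F i = z i + compSum (fun I => (-1) ^ I.length * coarseSum X I) (xi F) (z i) := by
  have h0 : PowerSeries.coeff 0 (opSeries F.toLinearMap) = 1 := by
    rw [PowerSeries.coeff_zero_eq_constantCoeff_apply, hF.constantCoeff_opSeries]
  have h := compSum_binom_eq_compSum_coarseSum
    (y := fun m => PowerSeries.coeff m (opSeries F.toLinearMap))
    (h := fun m => -PowerSeries.coeff m (mSeries F)) h0 hF.opSeries_recurrence X (z i)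
  rw [hF.flow_eq_opSeries, h]
  refine congrArg (z i + ·) ?_
  have hxi (j : ℕ) : -PowerSeries.coeff (j - 1) (mSeries F) = (-1 : K) • xi F j := by
    rw [xi, neg_one_smul]
  refine compSum_congr fun m _ x => Finset.sum_congr rfl fun I _ => ?_
  rw [word, word, word_eq_smul I.blocks fun j _ => hxi j, List.map_const', List.prod_replicate,
    LinearMap.smul_apply, FormalSeries.smul_apply, map_mul, map_pow, map_neg, map_one,
    Composition.blocks_length]
  ring

end Flow

end FormalFlow
end

open FormalFlow in
theorem mainTheorem2 {K : Type*} [CommRing K] [Algebra ℚ K] (k : VarKind) (n : ℕ)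
    (α : ℕ) (hα : 1 ≤ α) (F : Aut k n K) (hF : MemAut α F) :
    (∀ d : PowerSeries (Module.End K (Ser k n K)), PowerSeries.constantCoeff d = 0 →
      (expSeries K d = gSeries F ↔ d = dSeries F)) ∧
    ∀ i : Fin n,
      flow F i = z i + compSum (fun I =>
        Polynomial.C (algebraMap ℚ K (1 / (sp I.blocks : ℚ))) * (-Polynomial.X) ^ I.length)
        (phi F) (z i) ∧
      flow F i = z i + compSum (fun {m} I =>
        (-1) ^ m * binom Polynomial.X I.length) (lam F) (z i) ∧
      flow F i = z i + compSum (fun I =>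
        binom (-Polynomial.X) I.length) (s F) (z i) ∧
      flow F i = z i + compSum (fun I =>
        coarseSum (-Polynomial.X) I) (psi F) (z i) ∧
      flow F i = z i + compSum (fun I =>
        (-1) ^ I.length * coarseSum Polynomial.X I) (xi F) (z i) := by
  refine ⟨fun d hd => ⟨?_, ?_⟩, fun i => ⟨flow_eq_phi F i, hF.flow_eq_lam i,
    hF.flow_eq_gSeries i, hF.flow_eq_psi i, hF.flow_eq_xi i⟩⟩
  · intro h
    rw [dSeries, ← h, logSeries_expSeries hd]
  · rintro rfl
    exact expSeries_logSeries hF.constantCoeff_gSeries
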